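/- A lattice $(3,k)$-polytope is the convex hull of a nonempty finite set of points of $\mathbb{Z}^3$ that is contained in the cube $[0,k]^3$. The distance $d(P,Q)$ between two such polytopes is the smallest Euclidean distance between a point of $P$ and a point of $Q$, and $\varepsilon(3,k)$ denotes the smallest distance between two disjoint lattice $(3,k)$-polytopes. Theorem 1.1. Let $k$ be a positive integer other than $3$. Then the minimum $\varepsilon(3,k)$ exists and $$\varepsilon(3,k)=\frac{1}{\sqrt{2(2k^2-4k+5)(2k^2-2k+1)}}.$$ Moreover, assume that $k\geq 6$, let $P^\star$ be the line segment with extremities $(k,2,1)$ and $(0,k-1,k)$, and let $Q^\star$ be the line segment with extremities $(0,0,0)$ and $(k-1,k,k)$. Then $P^\star$ and $Q^\star$ are disjoint lattice $(3,k)$-polytopes and $d(P^\star,Q^\star)=\varepsilon(3,k)$. Conversely, if $P$ and $Q$ are disjoint lattice $(3,k)$-polytopes whose dimensions sum to at most $2$ (in particular, if they are two line segments) and $d(P,Q)=\varepsilon(3,k)$, then some isometry of $\mathbb{R}^3$ that maps the cube $[0,k]^3$ onto itself maps the pair $\{P,Q\}$ to the pair $\{P^\star,Q^\star\}$. -/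

import Mathlib

namespace KissingPolytopes

/-- The point of Euclidean space `ℝ^d` with integer coordinates `v`. -/
noncomputable def latticePoint {d : ℕ} (v : Fin d → ℤ) : EuclideanSpace ℝ (Fin d) :=
  WithLp.toLp 2 (fun i => (v i : ℝ))

/-- A (nonempty) lattice polytope: the convex hull of a nonempty finite set of points of `ℤ^d`. -/
def IsLatticePolytope {d : ℕ} (P : Set (EuclideanSpace ℝ (Fin d))) : Prop :=
  ∃ V : Finset (Fin d → ℤ), V.Nonempty ∧ P = convexHull ℝ (latticePoint '' (V : Set (Fin d → ℤ)))

/-- The cube `[0,k]^d`. -/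
def cube (d k : ℕ) : Set (EuclideanSpace ℝ (Fin d)) :=
  {x | ∀ i, x i ∈ Set.Icc (0 : ℝ) (k : ℝ)}

/-- A lattice `(d,k)`-polytope: a lattice polytope contained in the cube `[0,k]^d`. -/
def IsLatticeDKPolytope (d k : ℕ) (P : Set (EuclideanSpace ℝ (Fin d))) : Prop :=
  IsLatticePolytope P ∧ P ⊆ cube d k

/-- The Euclidean distance `d(P,Q)` between two (nonempty) sets: the infimum of `dist p q`
over all `p ∈ P` and `q ∈ Q`. -/
noncomputable def setDist {d : ℕ} (P Q : Set (EuclideanSpace ℝ (Fin d))) : ℝ :=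
  sInf (Set.image2 dist P Q)

/-- All the distances between two disjoint lattice `(d,k)`-polytopes. -/
def polytopeDistances (d k : ℕ) : Set ℝ :=
  {r | ∃ P Q : Set (EuclideanSpace ℝ (Fin d)),
    IsLatticeDKPolytope d k P ∧ IsLatticeDKPolytope d k Q ∧ Disjoint P Q ∧ setDist P Q = r}

/-- `ε(d,k)`: the smallest distance between two disjoint lattice `(d,k)`-polytopes. -/
noncomputable def kissingDistance (d k : ℕ) : ℝ :=
  sInf (polytopeDistances d k)

/-- The dimension of (the affine hull of) a set. -/
noncomputable def dimension {d : ℕ} (P : Set (EuclideanSpace ℝ (Fin d))) : ℕ :=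
  Module.finrank ℝ (vectorSpan ℝ P)

/-- The segment `P*` with extremities `(k,2,1)` and `(0,k-1,k)`. -/
noncomputable def PStar (k : ℕ) : Set (EuclideanSpace ℝ (Fin 3)) :=
  segment ℝ !₂[(k : ℝ), 2, 1] !₂[(0 : ℝ), (k : ℝ) - 1, (k : ℝ)]

/-- The segment `Q*` with extremities the origin and `(k-1,k,k)`. -/
noncomputable def QStar (k : ℕ) : Set (EuclideanSpace ℝ (Fin 3)) :=
  segment ℝ 0 !₂[(k : ℝ) - 1, (k : ℝ), (k : ℝ)]

/-- The symmetries of the cube `[0,k]^d`: the isometries of `ℝ^d` that map it onto itself. -/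
def IsCubeSymmetry (d k : ℕ)
    (σ : EuclideanSpace ℝ (Fin d) ≃ᵃⁱ[ℝ] EuclideanSpace ℝ (Fin d)) : Prop :=
  σ '' cube d k = cube d k

end KissingPolytopes

/-! The distance of two disjoint polytopes is the length of a nonzero vector `z` whose orthogonal
planes support both of them. Carathéodory's theorem inside a suitable hyperplane
(`exists_small_faces`) writes `z` as a difference of points in the hulls of at most four lattice
vertices in all, lying on those planes: two segments, or a vertex and a triangle. Let `u`, `v` be
the edge directions and `m` a difference of vertices. If `u` and `v` are independent, then `|z|² |u
× v|² = det(u, v, m)²` is a positive integer; otherwise `z` is too long to matter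
(`norm_sq_alternative`). A triangle has `|u × v|² ≤ 3k⁴ < bound k`, so only pairs of segments can be
extremal.

Reflections, exchanges of coordinates and reversals bring the directions to `(-x1, x2, x3)` and
`(y1, y2, y3)` with entries in `[0, k]`, apart from a sign pattern that also obeys `3k⁴`. Since `|u
× v|² ≤ 8k⁴ < 4 * bound k`, only determinant `±1` remains, an integer optimization problem
(`optimal`). In the defects `a = k - x`, `b = k - y`, the squared norm begins with `8k⁴ - 4wk³`,
where `w = 2(a1 + b1) + a2 + a3 + b2 + b3`, while `bound k = 8k⁴ - 24k³ + 40k² - 28k + 10`. Weight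
`w ≥ 7` gives too small a norm. For `w ≤ 6` the determinant is a polynomial in `k` with small lower
coefficients, so the value `±1` forces its nonconstant coefficients to vanish; a finite check then
leaves `w = 6` and eight extremal configurations, all symmetric to `P*`, `Q*`. This works for `k ≥
16`; smaller `k` are searched exhaustively, with pruning by convexity.

The bound is attained because the feet of the common perpendicular lie inside the segments. For
uniqueness, equality produces subsegments of `P` and `Q` symmetric to `P*` and `Q*`; these join
opposite facets, so no larger one-dimensional set in the cube contains them. -/

namespace KissingPolytopes

/-! ### Bounded search and the squared norm of the cross product -/

/-- Whether `p` holds at every natural number below the given bound. -/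
def allLT (p : ℕ → Bool) : ℕ → Bool
  | 0 => true
  | n + 1 => p n && allLT p n

theorem allLT_spec {p : ℕ → Bool} {n : ℕ} (h : allLT p n = true) {i : ℕ} (hi : i < n) :
    p i = true := by
  induction n with
  | zero => omega
  | succ n ih =>
    simp only [allLT, Bool.and_eq_true] at h
    rcases Nat.lt_succ_iff_lt_or_eq.mp hi with h' | rfl
    · exact ih h.2 h'
    · exact h.1

/-- Boolean form of `crossNorm x y < N`, without subtractions. -/
def crossLT (N x1 x2 x3 y1 y2 y3 : ℕ) : Bool :=
  Nat.ble (((x2 * y3) * (x2 * y3) + (x3 * y2) * (x3 * y2)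
    + (x3 * y1 + x1 * y3) * (x3 * y1 + x1 * y3) + (x1 * y2 + x2 * y1) * (x1 * y2 + x2 * y1)).succ)
    (N + 2 * ((x2 * y3) * (x3 * y2)))

/-- The squared norm of the cross product of `(-x1, x2, x3)` and `(y1, y2, y3)`. -/
def crossNorm (x1 x2 x3 y1 y2 y3 : ℤ) : ℤ :=
  (x2 * y3 - x3 * y2) ^ 2 + (x3 * y1 + x1 * y3) ^ 2 + (x1 * y2 + x2 * y1) ^ 2

/-- The inverse of the square of the smallest distance. -/
def bound (k : ℤ) : ℤ := 2 * (2 * k ^ 2 - 4 * k + 5) * (2 * k ^ 2 - 2 * k + 1)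

theorem crossLT_iff {N x1 x2 x3 y1 y2 y3 : ℕ} :
    crossLT N x1 x2 x3 y1 y2 y3 = true ↔ crossNorm x1 x2 x3 y1 y2 y3 < N := by
  rw [crossLT, Nat.ble_eq, Nat.succ_le_iff, crossNorm]
  zify
  constructor <;> intro h <;> linarith

/-! ### Convexity in each coordinate -/

/-- A convex parabola lies below its chord over `[0, k]`. The factor `k` in the products clears the
denominator of the chord. -/
theorem quadratic_lt {A B C M x k : ℤ} (hA : 0 ≤ A) (hx : 0 ≤ x) (hxk : x ≤ k)
    (h0 : C < M) (h1 : A * k ^ 2 + B * k + C < M) : A * x ^ 2 + B * x + C < M := by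
  rcases hx.eq_or_lt with rfl | hx
  · simpa using h0
  have hk : 0 < k := by linarith
  have h2 : 0 ≤ A * x * (k - x) * k := by
    have := sub_nonneg.mpr hxk
    positivity
  have h3 : (k - x) * C ≤ (k - x) * M := by nlinarith
  have h4 : x * (A * k ^ 2 + B * k + C) < x * M := by nlinarith
  have : k * (A * x ^ 2 + B * x + C) < k * M := by nlinarith
  exact lt_of_mul_lt_mul_left this hk.le

section convexity
variable {x1 x2 x3 y1 y2 y3 k M : ℤ}

theorem crossNorm_swap : crossNorm x1 x2 x3 y1 y2 y3 = crossNorm y1 y2 y3 x1 x2 x3 := by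
  unfold crossNorm; ring

theorem crossNorm_swap' : crossNorm x1 x2 x3 y1 y2 y3 = crossNorm x1 x3 x2 y1 y3 y2 := by
  unfold crossNorm; ring

/-- In `x2` alone this is a quadratic with leading coefficient `y3 ^ 2 + y1 ^ 2 ≥ 0`. The next three
lemmas follow by symmetry, and together they reduce a box to its corners. -/
theorem crossNorm_lt_x2 (h : 0 ≤ x2) (hk : x2 ≤ k) (h0 : crossNorm x1 0 x3 y1 y2 y3 < M)
    (h1 : crossNorm x1 k x3 y1 y2 y3 < M) : crossNorm x1 x2 x3 y1 y2 y3 < M := by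
  have := quadratic_lt (A := y3 ^ 2 + y1 ^ 2) (B := 2 * x1 * y2 * y1 - 2 * x3 * y2 * y3)
    (C := crossNorm x1 0 x3 y1 y2 y3) (by positivity) h hk h0
    (by unfold crossNorm at *; linarith)
  unfold crossNorm at *; linarith

theorem crossNorm_lt_x3 (h : 0 ≤ x3) (hk : x3 ≤ k) (h0 : crossNorm x1 x2 0 y1 y2 y3 < M)
    (h1 : crossNorm x1 x2 k y1 y2 y3 < M) : crossNorm x1 x2 x3 y1 y2 y3 < M := by
  rw [crossNorm_swap'] at *
  exact crossNorm_lt_x2 h hk h0 h1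

theorem crossNorm_lt_y2 (h : 0 ≤ y2) (hk : y2 ≤ k) (h0 : crossNorm x1 x2 x3 y1 0 y3 < M)
    (h1 : crossNorm x1 x2 x3 y1 k y3 < M) : crossNorm x1 x2 x3 y1 y2 y3 < M := by
  rw [crossNorm_swap] at *
  exact crossNorm_lt_x2 h hk h0 h1

theorem crossNorm_lt_y3 (h : 0 ≤ y3) (hk : y3 ≤ k) (h0 : crossNorm x1 x2 x3 y1 y2 0 < M)
    (h1 : crossNorm x1 x2 x3 y1 y2 k < M) : crossNorm x1 x2 x3 y1 y2 y3 < M := by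
  rw [crossNorm_swap] at *
  exact crossNorm_lt_x3 h hk h0 h1

end convexity

/-! ### Small `k`: branch and bound -/

/-- The defects and offsets of the extremal pairs of segments, once normalized. -/
def Exceptional (a1 a2 a3 b1 b2 b3 e1 e2 e3 : ℕ) : Prop :=
  [a1, a2, a3, b1, b2, b3, e1, e2, e3] ∈
    [[0, 1, 3, 1, 0, 0, 0, 0, 1], [0, 1, 3, 1, 0, 0, 1, 1, 2],
     [0, 3, 1, 1, 0, 0, 0, 1, 0], [0, 3, 1, 1, 0, 0, 1, 2, 1],
     [1, 0, 0, 0, 1, 3, 0, 1, 2], [1, 0, 0, 0, 1, 3, 1, 0, 1],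
     [1, 0, 0, 0, 3, 1, 0, 2, 1], [1, 0, 0, 0, 3, 1, 1, 1, 0]]

instance (a1 a2 a3 b1 b2 b3 e1 e2 e3 : ℕ) :
    Decidable (Exceptional a1 a2 a3 b1 b2 b3 e1 e2 e3) := by
  unfold Exceptional; infer_instance

/-- Whether the two segments are at lattice distance other than `1`. -/
def volNe (k x1 x2 x3 y1 y2 y3 e1 e2 e3 : ℕ) : Bool :=
  let s := x2 * y3 * (e1 + x1 + y1) + x3 * y2 * k + (x3 * y1 + x1 * y3) * (e2 + y2)
    + (x1 * y2 + x2 * y1) * k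
  let t := x3 * y2 * (e1 + x1 + y1) + x2 * y3 * k + (x3 * y1 + x1 * y3) * k
    + (x1 * y2 + x2 * y1) * (e3 + y3)
  !(Nat.beq s t.succ || Nat.beq t s.succ)

/-- Six times the volume spanned by two normalized segments. -/
def normalVol (k x1 x2 x3 y1 y2 y3 e1 e2 e3 : ℤ) : ℤ :=
  (x2 * y3 - x3 * y2) * (e1 + x1 + y1 - k) + (x3 * y1 + x1 * y3) * (e2 + y2 - k)
    - (x1 * y2 + x2 * y1) * (e3 + y3 - k)

theorem volNe_eq_false {k x1 x2 x3 y1 y2 y3 e1 e2 e3 : ℕ}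
    (h : normalVol k x1 x2 x3 y1 y2 y3 e1 e2 e3 = 1 ∨
      normalVol k x1 x2 x3 y1 y2 y3 e1 e2 e3 = -1) :
    volNe k x1 x2 x3 y1 y2 y3 e1 e2 e3 = false := by
  simp only [volNe, Bool.not_eq_false', Bool.or_eq_true, Nat.beq_eq]
  unfold normalVol at h
  zify
  rcases h with h | h
  · left; linarith
  · right; linarith

/-- Whether segments with the given directions satisfy the bound, or are extremal, for all offsets. -/
def leafCheck (k N x1 x2 x3 y1 y2 y3 : ℕ) : Bool :=
  crossLT N x1 x2 x3 y1 y2 y3 ||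
    allLT (fun e1 => allLT (fun e2 => allLT (fun e3 =>
      volNe k x1 x2 x3 y1 y2 y3 e1 e2 e3 ||
      (crossLT (N + 1) x1 x2 x3 y1 y2 y3 &&
        (Nat.ble k 3 ||
          decide (Exceptional (k - x1) (k - x2) (k - x3) (k - y1) (k - y2) (k - y3) e1 e2 e3))))
        (2 * k - x3 - y3).succ) (2 * k - x2 - y2).succ) (2 * k - x1 - y1).succ

/-- Whether `crossNorm` is below `N` at the corners of the box of the last two coordinates. -/
def cornerCheck₂ (k N x1 x2 y1 y2 : ℕ) : Bool :=
  crossLT N x1 x2 0 y1 y2 0 && (crossLT N x1 x2 0 y1 y2 k &&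
    (crossLT N x1 x2 k y1 y2 0 && crossLT N x1 x2 k y1 y2 k))

/-- Whether `crossNorm` is below `N` at the corners of the box of the last four coordinates. -/
def cornerCheck₁ (k N x1 y1 : ℕ) : Bool :=
  cornerCheck₂ k N x1 k y1 k && (cornerCheck₂ k N x1 0 y1 0 &&
    (cornerCheck₂ k N x1 0 y1 k && cornerCheck₂ k N x1 k y1 0))

/-- A branch and bound verification of the optimality of `N` over all normalized directions. -/
def boxCheck (k N : ℕ) : Bool :=
  allLT (fun x1 => allLT (fun y1 => cornerCheck₁ k N x1 y1 ||
    allLT (fun x2 => allLT (fun y2 => cornerCheck₂ k N x1 x2 y1 y2 ||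
      allLT (fun x3 => allLT (fun y3 => leafCheck k N x1 x2 x3 y1 y2 y3)
        k.succ) k.succ) k.succ) k.succ) k.succ) k.succ

/-- The numerals are the values of `bound k`. This is the only place where the lower bound needs `k
≠ 3`. -/
theorem boxCheck_small {k : ℕ} (hk : 0 < k) (hk3 : k ≠ 3) (hk16 : k < 16) :
    boxCheck k (bound k).toNat = true := by
  interval_cases k
  · exact (by decide +kernel : boxCheck 1 6 = true)
  · exact (by decide +kernel : boxCheck 2 50 = true)
  · exact absurd rfl hk3
  · exact (by decide +kernel : boxCheck 4 1050 = true)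
  · exact (by decide +kernel : boxCheck 5 2870 = true)
  · exact (by decide +kernel : boxCheck 6 6466 = true)
  · exact (by decide +kernel : boxCheck 7 12750 = true)
  · exact (by decide +kernel : boxCheck 8 22826 = true)
  · exact (by decide +kernel : boxCheck 9 37990 = true)
  · exact (by decide +kernel : boxCheck 10 59730 = true)
  · exact (by decide +kernel : boxCheck 11 89726 = true)
  · exact (by decide +kernel : boxCheck 12 129850 = true)
  · exact (by decide +kernel : boxCheck 13 182166 = true)
  · exact (by decide +kernel : boxCheck 14 248930 = true)
  · exact (by decide +kernel : boxCheck 15 332590 = true)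

theorem bound_pos (k : ℤ) : 0 < bound k := by
  unfold bound
  have h1 : 0 < 2 * k ^ 2 - 4 * k + 5 := by nlinarith [sq_nonneg (k - 1)]
  have h2 : 0 < 2 * k ^ 2 - 2 * k + 1 := by nlinarith [sq_nonneg k, sq_nonneg (k - 1)]
  positivity

section corners
variable {k N : ℕ} {x1 x2 x3 y1 y2 y3 : ℕ}

theorem crossNorm_lt_of_cornerCheck₂ (hx3 : x3 ≤ k) (hy3 : y3 ≤ k)
    (h : cornerCheck₂ k N x1 x2 y1 y2 = true) : crossNorm x1 x2 x3 y1 y2 y3 < N := by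
  simp only [cornerCheck₂, Bool.and_eq_true, crossLT_iff, Nat.cast_zero] at h
  obtain ⟨h1, h2, h3, h4⟩ := h
  have hx := Int.ofNat_le.mpr hx3
  have hy := Int.ofNat_le.mpr hy3
  exact crossNorm_lt_x3 (Nat.cast_nonneg _) hx
    (crossNorm_lt_y3 (Nat.cast_nonneg _) hy h1 h2) (crossNorm_lt_y3 (Nat.cast_nonneg _) hy h3 h4)

theorem crossNorm_lt_of_cornerCheck₁ (hx2 : x2 ≤ k) (hy2 : y2 ≤ k) (hx3 : x3 ≤ k) (hy3 : y3 ≤ k)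
    (h : cornerCheck₁ k N x1 y1 = true) : crossNorm x1 x2 x3 y1 y2 y3 < N := by
  simp only [cornerCheck₁, Bool.and_eq_true] at h
  obtain ⟨h1, h2, h3, h4⟩ := h
  have hx := Int.ofNat_le.mpr hx2
  have hy := Int.ofNat_le.mpr hy2
  have g1 := crossNorm_lt_of_cornerCheck₂ hx3 hy3 h1
  have g2 := crossNorm_lt_of_cornerCheck₂ hx3 hy3 h2
  have g3 := crossNorm_lt_of_cornerCheck₂ hx3 hy3 h3
  have g4 := crossNorm_lt_of_cornerCheck₂ hx3 hy3 h4
  rw [Nat.cast_zero] at *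
  exact crossNorm_lt_x2 (Nat.cast_nonneg _) hx
    (crossNorm_lt_y2 (Nat.cast_nonneg _) hy g2 g3) (crossNorm_lt_y2 (Nat.cast_nonneg _) hy g4 g1)

/-- A pruned branch bounds the norm through the corners of the coordinates not yet fixed; only the
other branches reach a leaf. -/
theorem boxCheck_spec (h : boxCheck k N = true) (hx1 : x1 ≤ k) (hy1 : y1 ≤ k)
    (hx2 : x2 ≤ k) (hy2 : y2 ≤ k) (hx3 : x3 ≤ k) (hy3 : y3 ≤ k) :
    leafCheck k N x1 x2 x3 y1 y2 y3 = true ∨ crossNorm x1 x2 x3 y1 y2 y3 < N := by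
  have h1 := allLT_spec (allLT_spec h (Nat.lt_succ_of_le hx1)) (Nat.lt_succ_of_le hy1)
  rcases (Bool.or_eq_true _ _).mp h1 with h1 | h1
  · exact Or.inr (crossNorm_lt_of_cornerCheck₁ hx2 hy2 hx3 hy3 h1)
  have h2 := allLT_spec (allLT_spec h1 (Nat.lt_succ_of_le hx2)) (Nat.lt_succ_of_le hy2)
  rcases (Bool.or_eq_true _ _).mp h2 with h2 | h2
  · exact Or.inr (crossNorm_lt_of_cornerCheck₂ hx3 hy3 h2)
  exact Or.inl (allLT_spec (allLT_spec h2 (Nat.lt_succ_of_le hx3)) (Nat.lt_succ_of_le hy3))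

end corners

/-- The conclusion of the integer optimization problem for normalized segments. -/
def Optimal (k x1 x2 x3 y1 y2 y3 e1 e2 e3 : ℕ) : Prop :=
  crossNorm x1 x2 x3 y1 y2 y3 < bound k ∨ (crossNorm x1 x2 x3 y1 y2 y3 = bound k ∧
    (4 ≤ k → Exceptional (k - x1) (k - x2) (k - x3) (k - y1) (k - y2) (k - y3) e1 e2 e3))

theorem optimal_of_lt_16 {k x1 x2 x3 y1 y2 y3 e1 e2 e3 : ℕ} (hk : 0 < k) (hk3 : k ≠ 3)
    (hk16 : k < 16) (hx1 : x1 ≤ k) (hy1 : y1 ≤ k) (hx2 : x2 ≤ k) (hy2 : y2 ≤ k) (hx3 : x3 ≤ k)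
    (hy3 : y3 ≤ k) (he1 : e1 + x1 + y1 ≤ 2 * k) (he2 : e2 + x2 + y2 ≤ 2 * k)
    (he3 : e3 + x3 + y3 ≤ 2 * k)
    (hD : normalVol k x1 x2 x3 y1 y2 y3 e1 e2 e3 = 1 ∨
      normalVol k x1 x2 x3 y1 y2 y3 e1 e2 e3 = -1) :
    Optimal k x1 x2 x3 y1 y2 y3 e1 e2 e3 := by
  have hN : (((bound k).toNat : ℕ) : ℤ) = bound k := Int.toNat_of_nonneg (bound_pos _).le
  rcases boxCheck_spec (boxCheck_small hk hk3 hk16) hx1 hy1 hx2 hy2 hx3 hy3 with h | h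
  · rcases (Bool.or_eq_true _ _).mp h with h | h
    · rw [crossLT_iff, hN] at h
      exact Or.inl h
    have h' := allLT_spec (allLT_spec (allLT_spec h (i := e1) (by omega)) (i := e2) (by omega))
      (i := e3) (by omega)
    rw [volNe_eq_false hD, Bool.false_or, Bool.and_eq_true, Bool.or_eq_true, Nat.ble_eq,
      decide_eq_true_eq, crossLT_iff, Nat.cast_succ, hN] at h'
    rcases (Int.lt_add_one_iff.mp h'.1).lt_or_eq with h2 | h2
    · exact Or.inl h2
    · refine Or.inr ⟨h2, fun h4 => h'.2.resolve_left (by omega)⟩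
  · rw [hN] at h
    exact Or.inl h

/-! ### Large `k`: expansion in the defects -/

section coefficients
variable (a1 a2 a3 b1 b2 b3 e1 e2 e3 : ℤ)

/-- The coefficient of `k ^ 2` in `crossNorm`, as a polynomial in `k`, in terms of the defects. -/
def normCoeff₂ : ℤ :=
  (a3 + b2 - a2 - b3) ^ 2 + (a3 + b1 + a1 + b3) ^ 2 + (a1 + b2 + a2 + b1) ^ 2
    + 4 * (a3 * b1 + a1 * b3) + 4 * (a1 * b2 + a2 * b1)

/-- The linear coefficient of `crossNorm` in terms of the defects. -/
def normCoeff₁ : ℤ :=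
  2 * (a3 + b2 - a2 - b3) * (a2 * b3 - a3 * b2) - 2 * (a3 + b1 + a1 + b3) * (a3 * b1 + a1 * b3)
    - 2 * (a1 + b2 + a2 + b1) * (a1 * b2 + a2 * b1)

/-- The constant coefficient of `crossNorm` in terms of the defects. -/
def normCoeff₀ : ℤ :=
  (a2 * b3 - a3 * b2) ^ 2 + (a3 * b1 + a1 * b3) ^ 2 + (a1 * b2 + a2 * b1) ^ 2

theorem crossNorm_defects (k : ℤ) :
    crossNorm (k - a1) (k - a2) (k - a3) (k - b1) (k - b2) (k - b3) =
      8 * k ^ 4 - 4 * (2 * (a1 + b1) + a2 + a3 + b2 + b3) * k ^ 3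
        + normCoeff₂ a1 a2 a3 b1 b2 b3 * k ^ 2 + normCoeff₁ a1 a2 a3 b1 b2 b3 * k
        + normCoeff₀ a1 a2 a3 b1 b2 b3 := by
  unfold crossNorm normCoeff₀ normCoeff₁ normCoeff₂; ring

/-- The coefficient of `k ^ 2` in `normalVol`, as a polynomial in `k`, in terms of the defects. -/
def volCoeff₂ : ℤ := a3 + b2 - a2 - b3 + 2 * (e2 - b2) - 2 * (e3 - b3)

/-- The linear coefficient of `normalVol` in terms of the defects. -/
def volCoeff₁ : ℤ :=
  a2 * b3 - a3 * b2 + (a3 + b2 - a2 - b3) * (e1 - b1 - a1) - (a3 + b1 + a1 + b3) * (e2 - b2)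
    + (a1 + b2 + a2 + b1) * (e3 - b3)

/-- The constant coefficient of `normalVol` in terms of the defects. -/
def volCoeff₀ : ℤ :=
  (a2 * b3 - a3 * b2) * (e1 - b1 - a1) + (a3 * b1 + a1 * b3) * (e2 - b2)
    - (a1 * b2 + a2 * b1) * (e3 - b3)

theorem normalVol_defects (k : ℤ) :
    normalVol k (k - a1) (k - a2) (k - a3) (k - b1) (k - b2) (k - b3) e1 e2 e3 =
      volCoeff₂ a2 a3 b2 b3 e2 e3 * k ^ 2 + volCoeff₁ a1 a2 a3 b1 b2 b3 e1 e2 e3 * k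
        + volCoeff₀ a1 a2 a3 b1 b2 b3 e1 e2 e3 := by
  unfold normalVol volCoeff₀ volCoeff₁ volCoeff₂; ring

end coefficients

/-- Whether `p` holds for all defects of weight `w`. -/
def allWeight (w : ℕ) (p : ℕ → ℕ → ℕ → ℕ → ℕ → ℕ → Bool) : Bool :=
  allLT (fun a1 => allLT (fun b1 => Nat.ble (w.succ) (2 * (a1 + b1)) ||
    allLT (fun a2 => allLT (fun a3 => Nat.ble (w.succ) (2 * (a1 + b1) + a2 + a3) ||
      allLT (fun b2 => Nat.ble (w.succ) (2 * (a1 + b1) + a2 + a3 + b2) ||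
        p a1 a2 a3 b1 b2 (w - (2 * (a1 + b1) + a2 + a3 + b2)))
    w.succ) w.succ) w.succ) w.succ) w.succ

theorem allWeight_spec {w : ℕ} {p : ℕ → ℕ → ℕ → ℕ → ℕ → ℕ → Bool} (h : allWeight w p = true)
    {a1 a2 a3 b1 b2 b3 : ℕ} (hw : 2 * (a1 + b1) + a2 + a3 + b2 + b3 = w) :
    p a1 a2 a3 b1 b2 b3 = true := by
  have h1 := allLT_spec (allLT_spec h (i := a1) (by omega)) (i := b1) (by omega)
  rw [Bool.or_eq_true, Nat.ble_eq] at h1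
  have h2 := allLT_spec (allLT_spec (h1.resolve_left (by omega)) (i := a2) (by omega))
    (i := a3) (by omega)
  rw [Bool.or_eq_true, Nat.ble_eq] at h2
  have h3 := allLT_spec (h2.resolve_left (by omega)) (i := b2) (by omega)
  rw [Bool.or_eq_true, Nat.ble_eq] at h3
  have h4 := h3.resolve_left (by omega)
  rwa [show w - (2 * (a1 + b1) + a2 + a3 + b2) = b3 by omega] at h4

theorem normCoeff_le {a1 a2 a3 b1 b2 b3 : ℕ} (hw : 2 * (a1 + b1) + a2 + a3 + b2 + b3 = 7) :
    normCoeff₂ a1 a2 a3 b1 b2 b3 ≤ 98 ∧ normCoeff₁ a1 a2 a3 b1 b2 b3 ≤ 6 ∧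
      normCoeff₀ a1 a2 a3 b1 b2 b3 ≤ 144 := by
  have h : allWeight 7 (fun a1 a2 a3 b1 b2 b3 => decide (normCoeff₂ a1 a2 a3 b1 b2 b3 ≤ 98) &&
      (decide (normCoeff₁ a1 a2 a3 b1 b2 b3 ≤ 6) &&
        decide (normCoeff₀ a1 a2 a3 b1 b2 b3 ≤ 144))) = true := by decide +kernel
  simpa using allWeight_spec h hw

/-- The cubic terms are `-28k³` against `-24k³`, so with the bounds of `normCoeff_le` it suffices
that `4k³ > 58k² + 34k + 134`. The first natural number satisfying this is `16`, whence the
threshold between small and large `k`. -/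
theorem crossNorm_lt_bound_of_weight_eq {k : ℤ} (hk : 16 ≤ k) {a1 a2 a3 b1 b2 b3 : ℕ}
    (hw : 2 * (a1 + b1) + a2 + a3 + b2 + b3 = 7) :
    crossNorm (k - a1) (k - a2) (k - a3) (k - b1) (k - b2) (k - b3) < bound k := by
  obtain ⟨h2, h1, h0⟩ := normCoeff_le hw
  have hw' : (2 * (a1 + b1) + a2 + a3 + b2 + b3 : ℤ) = 7 := by exact_mod_cast hw
  rw [crossNorm_defects, hw']
  have g2 := mul_le_mul_of_nonneg_right h2 (sq_nonneg k)
  have g1 := mul_le_mul_of_nonneg_right h1 (show 0 ≤ k by linarith)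
  obtain ⟨j, rfl⟩ : ∃ j, k = j + 16 := ⟨k - 16, by ring⟩
  have hj : 0 ≤ j := by linarith
  unfold bound
  nlinarith [pow_nonneg hj 2, pow_nonneg hj 3]

/-- Without `x2` the three squares are at most `k⁴`, `4k⁴` and `k⁴`, and `6k⁴` is well below the
leading term `8k⁴` of the bound. -/
theorem crossNorm_lt_bound_of_x2_eq_zero {k x1 x3 y1 y2 y3 : ℤ} (hk : 16 ≤ k)
    (hx1 : 0 ≤ x1) (hx1k : x1 ≤ k) (hx3 : 0 ≤ x3) (hx3k : x3 ≤ k) (hy1 : 0 ≤ y1) (hy1k : y1 ≤ k)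
    (hy2 : 0 ≤ y2) (hy2k : y2 ≤ k) (hy3 : 0 ≤ y3) (hy3k : y3 ≤ k) :
    crossNorm x1 0 x3 y1 y2 y3 < bound k := by
  have hk0 : 0 ≤ k := by linarith
  have h1 : x3 * y2 ≤ k * k := mul_le_mul hx3k hy2k hy2 hk0
  have h2 : x3 * y1 ≤ k * k := mul_le_mul hx3k hy1k hy1 hk0
  have h3 : x1 * y3 ≤ k * k := mul_le_mul hx1k hy3k hy3 hk0
  have h4 : x1 * y2 ≤ k * k := mul_le_mul hx1k hy2k hy2 hk0
  have g1 : (x3 * y2) ^ 2 ≤ (k * k) ^ 2 := pow_le_pow_left₀ (by positivity) h1 2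
  have g2 : (x3 * y1 + x1 * y3) ^ 2 ≤ (k * k + k * k) ^ 2 :=
    pow_le_pow_left₀ (by positivity) (add_le_add h2 h3) 2
  have g3 : (x1 * y2) ^ 2 ≤ (k * k) ^ 2 := pow_le_pow_left₀ (by positivity) h4 2
  have : 6 * k ^ 4 < bound k := by
    obtain ⟨j, rfl⟩ : ∃ j, k = j + 16 := ⟨k - 16, by ring⟩
    have hj : 0 ≤ j := by linarith
    unfold bound
    nlinarith [pow_nonneg hj 2, pow_nonneg hj 3, pow_nonneg hj 4]
  unfold crossNorm
  nlinarith

/-- Convexity over `[0, x2 + 1]`: both ends are below the bound, hence so is `x2`. This lets a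
defect grow by one, the inductive step on the weight. -/
theorem crossNorm_lt_bound_of_x2_lt {k x1 x2 x3 y1 y2 y3 : ℤ} (hk : 16 ≤ k)
    (hx1 : 0 ≤ x1) (hx1k : x1 ≤ k) (hx2 : 0 ≤ x2) (hx3 : 0 ≤ x3) (hx3k : x3 ≤ k)
    (hy1 : 0 ≤ y1) (hy1k : y1 ≤ k)
    (hy2 : 0 ≤ y2) (hy2k : y2 ≤ k) (hy3 : 0 ≤ y3) (hy3k : y3 ≤ k)
    (h : crossNorm x1 (x2 + 1) x3 y1 y2 y3 < bound k) :
    crossNorm x1 x2 x3 y1 y2 y3 < bound k :=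
  crossNorm_lt_x2 hx2 (by linarith)
    (crossNorm_lt_bound_of_x2_eq_zero hk hx1 hx1k hx3 hx3k hy1 hy1k hy2 hy2k hy3 hy3k) h

theorem crossNorm_lt_bound_of_weight {k : ℤ} (hk : 16 ≤ k) (n : ℕ) {a1 a2 a3 b1 b2 b3 : ℕ}
    (h1 : a1 ≤ k) (h2 : a2 ≤ k) (h3 : a3 ≤ k) (h4 : b1 ≤ k) (h5 : b2 ≤ k) (h6 : b3 ≤ k)
    (hw : 2 * (a1 + b1) + a2 + a3 + b2 + b3 = 7 + n) :
    crossNorm (k - a1) (k - a2) (k - a3) (k - b1) (k - b2) (k - b3) < bound k := by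
  induction n generalizing a1 a2 a3 b1 b2 b3 with
  | zero => exact crossNorm_lt_bound_of_weight_eq hk hw
  | succ n ih =>
    -- If one of these four defects is positive, lowering it by one lowers the weight by exactly
    -- one. If all vanish, the weight is `2(a1 + b1) ≥ 8` and the norm equals `2k²(2k - a1 - b1)²`.
    by_cases hp : a2 = 0 ∧ a3 = 0 ∧ b2 = 0 ∧ b3 = 0
    · obtain ⟨rfl, rfl, rfl, rfl⟩ := hp
      have he : (4 : ℤ) ≤ a1 + b1 := by omega
      have h : (2 * k - (a1 + b1)) ^ 2 ≤ (2 * k - 4) ^ 2 :=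
        pow_le_pow_left₀ (by linarith) (by linarith) 2
      have h' : (2 * k ^ 2) * (2 * k - (a1 + b1)) ^ 2 ≤ (2 * k ^ 2) * (2 * k - 4) ^ 2 :=
        mul_le_mul_of_nonneg_left h (by positivity)
      have : (2 * k ^ 2) * (2 * k - 4) ^ 2 < bound k := by
        obtain ⟨j, rfl⟩ : ∃ j, k = j + 16 := ⟨k - 16, by ring⟩
        have hj : 0 ≤ j := by linarith
        unfold bound
        nlinarith [pow_nonneg hj 2, pow_nonneg hj 3, pow_nonneg hj 4]
      unfold crossNorm
      push_cast
      linarith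
    · have hpos : (0 < a2 ∨ 0 < a3) ∨ 0 < b2 ∨ 0 < b3 := by omega
      rcases hpos with (h | h) | h | h
      · obtain ⟨c, rfl⟩ : ∃ c, a2 = c + 1 := ⟨a2 - 1, by omega⟩
        have := ih (a1 := a1) (a2 := c) (a3 := a3) (b1 := b1) (b2 := b2) (b3 := b3)
          h1 (by omega) h3 h4 h5 h6 (by omega)
        refine crossNorm_lt_bound_of_x2_lt hk ?_ ?_ ?_ ?_ ?_ ?_ ?_ ?_ ?_ ?_ ?_ ?_ <;> try omega
        convert this using 2; push_cast; ring
      · obtain ⟨c, rfl⟩ : ∃ c, a3 = c + 1 := ⟨a3 - 1, by omega⟩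
        have := ih (a1 := a1) (a2 := a2) (a3 := c) (b1 := b1) (b2 := b2) (b3 := b3)
          h1 h2 (by omega) h4 h5 h6 (by omega)
        rw [crossNorm_swap'] at this ⊢
        refine crossNorm_lt_bound_of_x2_lt hk ?_ ?_ ?_ ?_ ?_ ?_ ?_ ?_ ?_ ?_ ?_ ?_ <;> try omega
        convert this using 2; push_cast; ring
      · obtain ⟨c, rfl⟩ : ∃ c, b2 = c + 1 := ⟨b2 - 1, by omega⟩
        have := ih (a1 := a1) (a2 := a2) (a3 := a3) (b1 := b1) (b2 := c) (b3 := b3)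
          h1 h2 h3 h4 (by omega) h6 (by omega)
        rw [crossNorm_swap] at this ⊢
        refine crossNorm_lt_bound_of_x2_lt hk ?_ ?_ ?_ ?_ ?_ ?_ ?_ ?_ ?_ ?_ ?_ ?_ <;> try omega
        convert this using 2; push_cast; ring
      · obtain ⟨c, rfl⟩ : ∃ c, b3 = c + 1 := ⟨b3 - 1, by omega⟩
        have := ih (a1 := a1) (a2 := a2) (a3 := a3) (b1 := b1) (b2 := b2) (b3 := c)
          h1 h2 h3 h4 h5 (by omega) (by omega)
        rw [crossNorm_swap, crossNorm_swap'] at this ⊢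
        refine crossNorm_lt_bound_of_x2_lt hk ?_ ?_ ?_ ?_ ?_ ?_ ?_ ?_ ?_ ?_ ?_ ?_ <;> try omega
        convert this using 2; push_cast; ring

/-- The property of defects of small weight that is checked by computation. -/
def defectCheck (a1 a2 a3 b1 b2 b3 : ℕ) : Bool :=
  allLT (fun e1 => allLT (fun e2 => allLT (fun e3 =>
    decide (|volCoeff₁ a1 a2 a3 b1 b2 b3 e1 e2 e3| ≤ 9) &&
    (decide (|volCoeff₀ a1 a2 a3 b1 b2 b3 e1 e2 e3| ≤ 4) &&
    (decide (volCoeff₂ a2 a3 b2 b3 e2 e3 ≠ 0) ||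
    (decide (volCoeff₁ a1 a2 a3 b1 b2 b3 e1 e2 e3 ≠ 0) ||
    (decide (|volCoeff₀ a1 a2 a3 b1 b2 b3 e1 e2 e3| ≠ 1) ||
    (Nat.beq (2 * (a1 + b1) + a2 + a3 + b2 + b3) 6 &&
      ((decide (Exceptional a1 a2 a3 b1 b2 b3 e1 e2 e3) &&
        decide (normCoeff₂ a1 a2 a3 b1 b2 b3 = 40 ∧ normCoeff₁ a1 a2 a3 b1 b2 b3 = -28 ∧
          normCoeff₀ a1 a2 a3 b1 b2 b3 = 10)) ||
        decide (normCoeff₂ a1 a2 a3 b1 b2 b3 ≤ 36 ∧ normCoeff₁ a1 a2 a3 b1 b2 b3 ≤ 4 ∧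
          normCoeff₀ a1 a2 a3 b1 b2 b3 ≤ 26))))))))
    (a3 + b3).succ) (a2 + b2).succ) (a1 + b1).succ

theorem defectCheck_of_weight_le {a1 a2 a3 b1 b2 b3 : ℕ}
    (hw : 2 * (a1 + b1) + a2 + a3 + b2 + b3 ≤ 6) : defectCheck a1 a2 a3 b1 b2 b3 = true := by
  have h : allLT (fun w => allWeight w defectCheck) 7 = true := by decide +kernel
  exact allWeight_spec (allLT_spec h (Nat.lt_succ_of_le hw)) rfl

/-- Uniqueness of digits in base `k`: `(αk + β)k` is within `5` of zero, hence zero as `k ≥ 16`;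
then `|αk| ≤ 9` forces `α = 0`. -/
theorem digits_eq_zero {k α β γ : ℤ} (hk : 16 ≤ k) (hβ : |β| ≤ 9) (hγ : |γ| ≤ 4)
    (h : α * k ^ 2 + β * k + γ = 1 ∨ α * k ^ 2 + β * k + γ = -1) :
    α = 0 ∧ β = 0 ∧ |γ| = 1 := by
  rw [abs_le] at hβ hγ
  have h1 : -5 ≤ (α * k + β) * k ∧ (α * k + β) * k ≤ 5 := by
    constructor <;> rcases h with h | h <;> nlinarith
  have h2 : α * k + β = 0 := by
    by_contra h0
    rcases lt_or_gt_of_ne h0 with h0 | h0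
    · nlinarith
    · nlinarith
  have h3 : α = 0 := by
    by_contra h0
    rcases lt_or_gt_of_ne h0 with h0 | h0
    · nlinarith
    · nlinarith
  subst h3
  have h4 : β = 0 := by linarith
  subst h4
  refine ⟨rfl, rfl, ?_⟩
  rcases h with h | h
  · rw [show γ = 1 by linarith]; rfl
  · rw [show γ = -1 by linarith]; rfl

theorem optimal_of_ge_16 {k x1 x2 x3 y1 y2 y3 e1 e2 e3 : ℕ}
    (hk : 16 ≤ k) (hx1 : x1 ≤ k) (hy1 : y1 ≤ k) (hx2 : x2 ≤ k) (hy2 : y2 ≤ k) (hx3 : x3 ≤ k)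
    (hy3 : y3 ≤ k) (he1 : e1 + x1 + y1 ≤ 2 * k) (he2 : e2 + x2 + y2 ≤ 2 * k)
    (he3 : e3 + x3 + y3 ≤ 2 * k)
    (hD : normalVol k x1 x2 x3 y1 y2 y3 e1 e2 e3 = 1 ∨
      normalVol k x1 x2 x3 y1 y2 y3 e1 e2 e3 = -1) :
    Optimal k x1 x2 x3 y1 y2 y3 e1 e2 e3 := by
  obtain ⟨a1, ha1⟩ := Nat.exists_eq_add_of_le hx1
  obtain ⟨a2, ha2⟩ := Nat.exists_eq_add_of_le hx2
  obtain ⟨a3, ha3⟩ := Nat.exists_eq_add_of_le hx3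
  obtain ⟨b1, hb1⟩ := Nat.exists_eq_add_of_le hy1
  obtain ⟨b2, hb2⟩ := Nat.exists_eq_add_of_le hy2
  obtain ⟨b3, hb3⟩ := Nat.exists_eq_add_of_le hy3
  have hk' : (16 : ℤ) ≤ k := by exact_mod_cast hk
  rw [show (x1 : ℤ) = k - a1 by omega, show (x2 : ℤ) = k - a2 by omega,
    show (x3 : ℤ) = k - a3 by omega, show (y1 : ℤ) = k - b1 by omega,
    show (y2 : ℤ) = k - b2 by omega, show (y3 : ℤ) = k - b3 by omega, normalVol_defects] at hD
  rw [Optimal, show (x1 : ℤ) = k - a1 by omega, show (x2 : ℤ) = k - a2 by omega,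
    show (x3 : ℤ) = k - a3 by omega, show (y1 : ℤ) = k - b1 by omega,
    show (y2 : ℤ) = k - b2 by omega, show (y3 : ℤ) = k - b3 by omega]
  rcases Nat.lt_or_ge (2 * (a1 + b1) + a2 + a3 + b2 + b3) 7 with hw | hw
  -- The offsets stay in the range searched, since `2k - x - y = a + b` in each coordinate.
  · have h := allLT_spec (allLT_spec (allLT_spec (defectCheck_of_weight_le (Nat.le_of_lt_succ hw))
      (i := e1) (by omega)) (i := e2) (by omega)) (i := e3) (by omega)
    simp only [Bool.and_eq_true, Bool.or_eq_true, decide_eq_true_eq, Nat.beq_eq] at h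
    obtain ⟨hβ, hγ, h⟩ := h
    obtain ⟨h2, h1, h0⟩ := digits_eq_zero hk' hβ hγ hD
    replace h := ((h.resolve_left (not_not.mpr h2)).resolve_left (not_not.mpr h1)).resolve_left
      (not_not.mpr h0)
    obtain ⟨hw6, h⟩ := h
    have hw' : (2 * (a1 + b1) + a2 + a3 + b2 + b3 : ℤ) = 6 := by exact_mod_cast hw6
    rw [crossNorm_defects, hw']
    rcases h with ⟨hE, c2, c1, c0⟩ | ⟨c2, c1, c0⟩
    · right
      -- With weight `6`, the coefficients `40`, `-28`, `10` are exactly those of `bound k`.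
      rw [c2, c1, c0]
      refine ⟨by unfold bound; ring, fun _ => ?_⟩
      convert hE using 1 <;> omega
    · left
      -- The quartic and cubic terms cancel, leaving `36k² + 4k + 26 < 40k² - 28k + 10`.
      have g2 := mul_le_mul_of_nonneg_right c2 (sq_nonneg (k : ℤ))
      have g1 := mul_le_mul_of_nonneg_right c1 (show 0 ≤ (k : ℤ) by linarith)
      unfold bound
      nlinarith
  · left
    obtain ⟨n, hn⟩ := Nat.exists_eq_add_of_le hw
    exact crossNorm_lt_bound_of_weight hk' n (by omega) (by omega) (by omega) (by omega)
      (by omega) (by omega) hn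

theorem optimal {k x1 x2 x3 y1 y2 y3 e1 e2 e3 : ℕ} (hk : 0 < k) (hk3 : k ≠ 3)
    (hx1 : x1 ≤ k) (hy1 : y1 ≤ k) (hx2 : x2 ≤ k) (hy2 : y2 ≤ k) (hx3 : x3 ≤ k)
    (hy3 : y3 ≤ k) (he1 : e1 + x1 + y1 ≤ 2 * k) (he2 : e2 + x2 + y2 ≤ 2 * k)
    (he3 : e3 + x3 + y3 ≤ 2 * k)
    (hD : normalVol k x1 x2 x3 y1 y2 y3 e1 e2 e3 = 1 ∨
      normalVol k x1 x2 x3 y1 y2 y3 e1 e2 e3 = -1) :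
    Optimal k x1 x2 x3 y1 y2 y3 e1 e2 e3 := by
  rcases Nat.lt_or_ge k 16 with h | h
  · exact optimal_of_lt_16 hk hk3 h hx1 hy1 hx2 hy2 hx3 hy3 he1 he2 he3 hD
  · exact optimal_of_ge_16 h hx1 hy1 hx2 hy2 hx3 hy3 he1 he2 he3 hD

/-! ### Symmetries of the cube and pairs equivalent to `P*`, `Q*` -/

theorem isCubeSymmetry_of_involutive {d k : ℕ}
    {σ : EuclideanSpace ℝ (Fin d) ≃ᵃⁱ[ℝ] EuclideanSpace ℝ (Fin d)}
    (h : ∀ x ∈ cube d k, σ x ∈ cube d k) (hσ : ∀ x, σ (σ x) = x) : IsCubeSymmetry d k σ :=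
  Set.Subset.antisymm (Set.image_subset_iff.mpr h) fun x hx => ⟨σ x, h x hx, hσ x⟩

theorem IsCubeSymmetry.trans {d k : ℕ}
    {σ τ : EuclideanSpace ℝ (Fin d) ≃ᵃⁱ[ℝ] EuclideanSpace ℝ (Fin d)}
    (hσ : IsCubeSymmetry d k σ) (hτ : IsCubeSymmetry d k τ) : IsCubeSymmetry d k (σ.trans τ) := by
  unfold IsCubeSymmetry at *
  rw [AffineIsometryEquiv.coe_trans, Set.image_comp, hσ, hτ]

/-- The reflection of `[0,k]^d` that exchanges the facets orthogonal to the `i`-th axis. -/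
noncomputable def cubeReflection {d : ℕ} (k : ℕ) (i : Fin d) :
    EuclideanSpace ℝ (Fin d) ≃ᵃⁱ[ℝ] EuclideanSpace ℝ (Fin d) :=
  (LinearIsometryEquiv.piLpCongrRight 2 (fun j : Fin d =>
    if j = i then LinearIsometryEquiv.neg ℝ else LinearIsometryEquiv.refl ℝ ℝ)).toAffineIsometryEquiv.trans
    (AffineIsometryEquiv.constVAdd ℝ _ (EuclideanSpace.single i (k : ℝ)))

theorem cubeReflection_apply {d : ℕ} (k : ℕ) (i j : Fin d) (x : EuclideanSpace ℝ (Fin d)) :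
    cubeReflection k i x j = if j = i then k - x j else x j := by
  by_cases h : j = i
  · subst h; simp [cubeReflection, sub_eq_add_neg]
  · simp [cubeReflection, h]

theorem isCubeSymmetry_cubeReflection {d : ℕ} (k : ℕ) (i : Fin d) :
    IsCubeSymmetry d k (cubeReflection k i) := by
  refine isCubeSymmetry_of_involutive (fun x hx j => ?_) fun x => ?_
  · rw [cubeReflection_apply]
    have := hx j
    rw [Set.mem_Icc] at this ⊢
    split_ifs <;> constructor <;> linarith
  · ext j
    rw [cubeReflection_apply, cubeReflection_apply]
    split_ifs <;> ring

/-- The symmetry of `[0,k]^d` that exchanges two coordinates. -/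
noncomputable def cubeSwap {d : ℕ} (i j : Fin d) :
    EuclideanSpace ℝ (Fin d) ≃ᵃⁱ[ℝ] EuclideanSpace ℝ (Fin d) :=
  (LinearIsometryEquiv.piLpCongrLeft 2 ℝ ℝ (Equiv.swap i j)).toAffineIsometryEquiv

theorem cubeSwap_apply {d : ℕ} (i j l : Fin d) (x : EuclideanSpace ℝ (Fin d)) :
    cubeSwap i j x l = x (Equiv.swap i j l) := by
  simp [cubeSwap, LinearIsometryEquiv.piLpCongrLeft_apply]

theorem isCubeSymmetry_cubeSwap {d : ℕ} (k : ℕ) (i j : Fin d) :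
    IsCubeSymmetry d k (cubeSwap i j) := by
  refine isCubeSymmetry_of_involutive (fun x hx l => ?_) fun x => ?_
  · rw [cubeSwap_apply]; exact hx _
  · ext l
    rw [cubeSwap_apply, cubeSwap_apply, Equiv.swap_apply_self]

/-- Reflection of lattice points. -/
def latReflection {d : ℕ} (k : ℕ) (i : Fin d) (p : Fin d → ℤ) : Fin d → ℤ :=
  fun j => if j = i then k - p j else p j

theorem latticePoint_latReflection {d : ℕ} (k : ℕ) (i : Fin d) (p : Fin d → ℤ) :
    latticePoint (latReflection k i p) = cubeReflection k i (latticePoint p) := by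
  ext j
  rw [cubeReflection_apply]
  by_cases h : j = i <;> simp [latReflection, latticePoint, h]

theorem latticePoint_comp_swap {d : ℕ} (i j : Fin d) (p : Fin d → ℤ) :
    latticePoint (p ∘ Equiv.swap i j) = cubeSwap i j (latticePoint p) := by
  ext l
  rw [cubeSwap_apply]
  rfl

/-- The segment between two lattice points. -/
noncomputable def latSegment {d : ℕ} (p p' : Fin d → ℤ) : Set (EuclideanSpace ℝ (Fin d)) :=
  segment ℝ (latticePoint p) (latticePoint p')

theorem latSegment_symm {d : ℕ} (p p' : Fin d → ℤ) : latSegment p p' = latSegment p' p :=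
  segment_symm _ _ _

/-- `P` and `Q` are, up to a symmetry of the cube, the segments `P*` and `Q*`. -/
def IsStarPair (k : ℕ) (P Q : Set (EuclideanSpace ℝ (Fin 3))) : Prop :=
  ∃ σ : EuclideanSpace ℝ (Fin 3) ≃ᵃⁱ[ℝ] EuclideanSpace ℝ (Fin 3), IsCubeSymmetry 3 k σ ∧
    ((σ '' P = PStar k ∧ σ '' Q = QStar k) ∨ (σ '' P = QStar k ∧ σ '' Q = PStar k))

theorem IsStarPair.symm {k : ℕ} {P Q : Set (EuclideanSpace ℝ (Fin 3))} (h : IsStarPair k P Q) :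
    IsStarPair k Q P := by
  obtain ⟨σ, hσ, h⟩ := h
  exact ⟨σ, hσ, h.symm.imp And.symm And.symm⟩

theorem IsStarPair.of_image {k : ℕ} {P Q : Set (EuclideanSpace ℝ (Fin 3))}
    {τ : EuclideanSpace ℝ (Fin 3) ≃ᵃⁱ[ℝ] EuclideanSpace ℝ (Fin 3)} (hτ : IsCubeSymmetry 3 k τ)
    (h : IsStarPair k (τ '' P) (τ '' Q)) : IsStarPair k P Q := by
  obtain ⟨σ, hσ, h⟩ := h
  refine ⟨τ.trans σ, hτ.trans hσ, ?_⟩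
  simpa only [AffineIsometryEquiv.coe_trans, Set.image_comp] using h

theorem image_latSegment {d : ℕ} {τ : EuclideanSpace ℝ (Fin d) ≃ᵃⁱ[ℝ] EuclideanSpace ℝ (Fin d)}
    {g : (Fin d → ℤ) → Fin d → ℤ} (hg : ∀ p, latticePoint (g p) = τ (latticePoint p))
    (p p' : Fin d → ℤ) : τ '' latSegment p p' = latSegment (g p) (g p') := by
  rw [latSegment, latSegment, hg, hg]
  exact image_segment ℝ τ.toAffineEquiv.toAffineMap _ _

theorem IsStarPair.of_latReflection {k : ℕ} (i : Fin 3) {p p' q q' : Fin 3 → ℤ}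
    (h : IsStarPair k (latSegment (latReflection k i p) (latReflection k i p'))
      (latSegment (latReflection k i q) (latReflection k i q'))) :
    IsStarPair k (latSegment p p') (latSegment q q') := by
  refine IsStarPair.of_image (isCubeSymmetry_cubeReflection k i) ?_
  rwa [image_latSegment (latticePoint_latReflection k i),
    image_latSegment (latticePoint_latReflection k i)]

theorem IsStarPair.of_swap {k : ℕ} (i j : Fin 3) {p p' q q' : Fin 3 → ℤ}
    (h : IsStarPair k (latSegment (p ∘ Equiv.swap i j) (p' ∘ Equiv.swap i j))
      (latSegment (q ∘ Equiv.swap i j) (q' ∘ Equiv.swap i j))) :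
    IsStarPair k (latSegment p p') (latSegment q q') := by
  refine IsStarPair.of_image (isCubeSymmetry_cubeSwap k i j) ?_
  rwa [image_latSegment (latticePoint_comp_swap i j),
    image_latSegment (latticePoint_comp_swap i j)]

theorem PStar_eq (k : ℕ) : PStar k = latSegment ![(k : ℤ), 2, 1] ![0, (k : ℤ) - 1, k] := by
  unfold PStar latSegment latticePoint
  congr 1 <;> ext i <;> fin_cases i <;> simp

theorem QStar_eq (k : ℕ) : QStar k = latSegment 0 ![(k : ℤ) - 1, k, k] := by
  unfold QStar latSegment latticePoint
  congr 1 <;> ext i <;> fin_cases i <;> simp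

theorem isStarPair_star (k : ℕ) : IsStarPair k (PStar k) (QStar k) := by
  refine ⟨AffineIsometryEquiv.refl ℝ _, ?_, Or.inl ⟨?_, ?_⟩⟩
  · simp [IsCubeSymmetry]
  · simp
  · simp

theorem isStarPair_of_eq {k : ℕ} {p p' q q' : Fin 3 → ℤ}
    (hp : p 0 = k ∧ p 1 = 2 ∧ p 2 = 1) (hp' : p' 0 = 0 ∧ p' 1 = k - 1 ∧ p' 2 = k)
    (hq : q 0 = 0 ∧ q 1 = 0 ∧ q 2 = 0) (hq' : q' 0 = k - 1 ∧ q' 1 = k ∧ q' 2 = k) :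
    IsStarPair k (latSegment p p') (latSegment q q') := by
  have h := isStarPair_star k
  rw [PStar_eq, QStar_eq] at h
  convert h using 2 <;> ext i <;> fin_cases i <;> simp [*]

/-- These are the images of `P*` and `Q*` under the reflection through the center of the cube, with
reversed ends. -/
theorem isStarPair_of_eq_center {k : ℕ} {p p' q q' : Fin 3 → ℤ}
    (hp : p 0 = k ∧ p 1 = 1 ∧ p 2 = 0) (hp' : p' 0 = 0 ∧ p' 1 = k - 2 ∧ p' 2 = k - 1)
    (hq : q 0 = 1 ∧ q 1 = 0 ∧ q 2 = 0) (hq' : q' 0 = k ∧ q' 1 = k ∧ q' 2 = k) :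
    IsStarPair k (latSegment p p') (latSegment q q') := by
  refine .of_latReflection 0 (.of_latReflection 1 (.of_latReflection 2 ?_))
  rw [latSegment_symm (latReflection _ _ _), latSegment_symm (latReflection _ _ (latReflection _ _ (latReflection _ _ q)))]
  apply isStarPair_of_eq <;> simp [latReflection, *]

/-! ### Invariance of the segment bound under symmetries -/

/-- The squared norm of the cross product of two vectors. -/
def crossSq {R : Type*} [CommRing R] (u v : Fin 3 → R) : R :=
  (u 1 * v 2 - u 2 * v 1) ^ 2 + (u 2 * v 0 - u 0 * v 2) ^ 2 + (u 0 * v 1 - u 1 * v 0) ^ 2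

/-- The determinant of three vectors. -/
def vol {R : Type*} [CommRing R] (u v w : Fin 3 → R) : R :=
  (u 1 * v 2 - u 2 * v 1) * w 0 + (u 2 * v 0 - u 0 * v 2) * w 1 + (u 0 * v 1 - u 1 * v 0) * w 2

/-- The lattice points of the cube. -/
def InBox (k : ℕ) (p : Fin 3 → ℤ) : Prop := ∀ i, 0 ≤ p i ∧ p i ≤ k

theorem InBox.latReflection {k : ℕ} {p : Fin 3 → ℤ} (h : InBox k p) (i : Fin 3) :
    InBox k (latReflection k i p) := by
  intro j
  have := h j
  unfold KissingPolytopes.latReflection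
  split_ifs <;> omega

theorem InBox.comp {k : ℕ} {p : Fin 3 → ℤ} (h : InBox k p) (f : Fin 3 → Fin 3) :
    InBox k (p ∘ f) := fun j => h (f j)

/-- The distance of the lines through two segments is bounded below, with the case of equality. -/
def SegmentBound (k : ℕ) (p p' q q' : Fin 3 → ℤ) : Prop :=
  vol (p' - p) (q' - q) (p - q) ≠ 0 →
    crossSq (p' - p) (q' - q) < bound k * vol (p' - p) (q' - q) (p - q) ^ 2 ∨
    (crossSq (p' - p) (q' - q) = bound k * vol (p' - p) (q' - q) (p - q) ^ 2 ∧
      (4 ≤ k → IsStarPair k (latSegment p p') (latSegment q q')))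

/-- The determinant enters only through its square, so a sign change is harmless. -/
theorem SegmentBound.of_eq {k : ℕ} {p p' q q' r r' s s' : Fin 3 → ℤ}
    (h : SegmentBound k r r' s s') (hc : crossSq (r' - r) (s' - s) = crossSq (p' - p) (q' - q))
    (hv : vol (r' - r) (s' - s) (r - s) = vol (p' - p) (q' - q) (p - q) ∨
      vol (r' - r) (s' - s) (r - s) = -vol (p' - p) (q' - q) (p - q))
    (hS : IsStarPair k (latSegment r r') (latSegment s s') →
      IsStarPair k (latSegment p p') (latSegment q q')) : SegmentBound k p p' q q' := by
  intro h0
  have h1 : vol (r' - r) (s' - s) (r - s) ≠ 0 := by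
    rcases hv with hv | hv <;> rw [hv] <;> simpa using h0
  rw [← hc, ← sq_eq_sq_iff_eq_or_eq_neg.mpr hv]
  exact (h h1).imp_right fun h2 => ⟨h2.1, fun h4 => hS (h2.2 h4)⟩

section symmetries
variable {R : Type*} [CommRing R] (i j : Fin 3) (u v w : Fin 3 → R)

/-- Change the sign of the `i`-th coordinate. -/
def negAt : Fin 3 → R := fun j => if j = i then -u j else u j

theorem crossSq_negAt : crossSq (negAt i u) (negAt i v) = crossSq u v := by
  fin_cases i <;> simp [crossSq, negAt] <;> ring

theorem vol_negAt : vol (negAt i u) (negAt i v) (negAt i w) = -vol u v w := by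
  fin_cases i <;> simp [vol, negAt] <;> ring

theorem crossSq_comp_swap :
    crossSq (u ∘ Equiv.swap i j) (v ∘ Equiv.swap i j) = crossSq u v := by
  fin_cases i <;> fin_cases j <;> simp [crossSq, Equiv.swap_apply_def] <;> ring

theorem vol_comp_swap (hij : i ≠ j) :
    vol (u ∘ Equiv.swap i j) (v ∘ Equiv.swap i j) (w ∘ Equiv.swap i j) = -vol u v w := by
  fin_cases i <;> fin_cases j <;> simp [vol, Equiv.swap_apply_def] at hij ⊢ <;> ring

theorem crossSq_neg_left : crossSq (-u) v = crossSq u v := by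
  simp only [crossSq, Pi.neg_apply]; ring

/-- Taking the other end of the first segment as base point adds `u` to `w`, which the determinant
ignores. -/
theorem vol_reverse : vol (-u) v (w + u) = -vol u v w := by
  simp only [vol, Pi.neg_apply, Pi.add_apply]; ring

end symmetries

theorem latReflection_sub (k : ℕ) (i : Fin 3) (p q : Fin 3 → ℤ) :
    latReflection k i p - latReflection k i q = negAt i (p - q) := by
  ext j
  simp only [latReflection, negAt, Pi.sub_apply]
  split_ifs <;> ring

theorem SegmentBound.of_latReflection {k : ℕ} (i : Fin 3) {p p' q q' : Fin 3 → ℤ}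
    (h : SegmentBound k (latReflection k i p) (latReflection k i p') (latReflection k i q)
      (latReflection k i q')) : SegmentBound k p p' q q' := by
  refine h.of_eq ?_ (Or.inr ?_) (.of_latReflection i) <;> simp only [latReflection_sub]
  · exact crossSq_negAt i _ _
  · exact vol_negAt i _ _ _

theorem SegmentBound.of_swap {k : ℕ} (i j : Fin 3) {p p' q q' : Fin 3 → ℤ}
    (h : SegmentBound k (p ∘ Equiv.swap i j) (p' ∘ Equiv.swap i j) (q ∘ Equiv.swap i j)
      (q' ∘ Equiv.swap i j)) : SegmentBound k p p' q q' := by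
  by_cases hij : i = j
  · subst hij; simpa using h
  · exact h.of_eq (crossSq_comp_swap i j (p' - p) (q' - q))
      (Or.inr (vol_comp_swap i j (p' - p) (q' - q) (p - q) hij)) (.of_swap i j)

theorem SegmentBound.of_reverse {k : ℕ} {p p' q q' : Fin 3 → ℤ}
    (h : SegmentBound k p' p q q') : SegmentBound k p p' q q' := by
  refine h.of_eq ?_ (Or.inr ?_) (by rw [latSegment_symm]; exact id)
  · rw [← neg_sub p' p, crossSq_neg_left]
  · rw [← neg_sub p' p, show p' - q = p - q + (p' - p) by abel, vol_reverse]

/-! ### Size estimates in the cube -/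

theorem mul_le_mul_posPart {a α k : ℤ} (ha : 0 ≤ a) (hak : a ≤ k) : a * α ≤ k * max α 0 :=
  (mul_le_mul_of_nonneg_left (le_max_left α 0) ha).trans
    (mul_le_mul_of_nonneg_right hak (le_max_right α 0))

/-- Twice the area of a triangle in a square. The determinant is `a1(b2 - c2) + b1(c2 - a2) + c1(a2
- b2)`, and the positive parts of these cyclic differences add up to the spread of `a2, b2, c2`, at
most `k`. -/
theorem triangle_det_le {k a1 a2 b1 b2 c1 c2 : ℤ} (ha1 : 0 ≤ a1 ∧ a1 ≤ k) (ha2 : 0 ≤ a2 ∧ a2 ≤ k)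
    (hb1 : 0 ≤ b1 ∧ b1 ≤ k) (hb2 : 0 ≤ b2 ∧ b2 ≤ k) (hc1 : 0 ≤ c1 ∧ c1 ≤ k)
    (hc2 : 0 ≤ c2 ∧ c2 ≤ k) : (b1 - a1) * (c2 - a2) - (b2 - a2) * (c1 - a1) ≤ k ^ 2 := by
  have h1 := mul_le_mul_posPart ha1.1 ha1.2 (α := b2 - c2)
  have h2 := mul_le_mul_posPart hb1.1 hb1.2 (α := c2 - a2)
  have h3 := mul_le_mul_posPart hc1.1 hc1.2 (α := a2 - b2)
  have h4 : max (b2 - c2) 0 + max (c2 - a2) 0 + max (a2 - b2) 0 ≤ k := by omega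
  have h5 := mul_le_mul_of_nonneg_left h4 (ha1.1.trans ha1.2)
  nlinarith

theorem triangle_det_sq_le {k a1 a2 b1 b2 c1 c2 : ℤ} (ha1 : 0 ≤ a1 ∧ a1 ≤ k)
    (ha2 : 0 ≤ a2 ∧ a2 ≤ k) (hb1 : 0 ≤ b1 ∧ b1 ≤ k) (hb2 : 0 ≤ b2 ∧ b2 ≤ k) (hc1 : 0 ≤ c1 ∧ c1 ≤ k)
    (hc2 : 0 ≤ c2 ∧ c2 ≤ k) : ((b1 - a1) * (c2 - a2) - (b2 - a2) * (c1 - a1)) ^ 2 ≤ k ^ 4 := by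
  have h1 := triangle_det_le ha1 ha2 hb1 hb2 hc1 hc2
  have h2 := triangle_det_le ha1 ha2 hc1 hc2 hb1 hb2
  rw [show k ^ 4 = (k ^ 2) ^ 2 by ring]
  exact sq_le_sq' (by linarith) h1

/-- The coordinates of the cross product are, up to sign, twice the areas of the projections of the
triangle to the coordinate planes. -/
theorem crossSq_triangle_le {k : ℕ} {a b c : Fin 3 → ℤ} (ha : InBox k a) (hb : InBox k b)
    (hc : InBox k c) : crossSq (b - a) (c - a) ≤ 3 * (k : ℤ) ^ 4 := by
  have h0 := triangle_det_sq_le (ha 1) (ha 2) (hb 1) (hb 2) (hc 1) (hc 2)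
  have h1 := triangle_det_sq_le (ha 2) (ha 0) (hb 2) (hb 0) (hc 2) (hc 0)
  have h2 := triangle_det_sq_le (ha 0) (ha 1) (hb 0) (hb 1) (hc 0) (hc 1)
  simp only [crossSq, Pi.sub_apply]
  linarith

theorem three_mul_pow_lt_bound {k : ℕ} (hk : 0 < k) : 3 * (k : ℤ) ^ 4 < bound k := by
  unfold bound
  rcases Nat.lt_or_ge k 3 with h | h
  · interval_cases k <;> norm_num
  · obtain ⟨j, rfl⟩ := Nat.exists_eq_add_of_le h
    push_cast
    nlinarith [pow_nonneg (Int.natCast_nonneg j) 2, pow_nonneg (Int.natCast_nonneg j) 3,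
      pow_nonneg (Int.natCast_nonneg j) 4]

theorem eight_mul_pow_lt_bound {k : ℕ} (hk : 0 < k) : 8 * (k : ℤ) ^ 4 < bound k * 4 := by
  unfold bound
  rcases Nat.lt_or_ge k 3 with h | h
  · interval_cases k <;> norm_num
  · obtain ⟨j, rfl⟩ := Nat.exists_eq_add_of_le h
    push_cast
    nlinarith [pow_nonneg (Int.natCast_nonneg j) 2, pow_nonneg (Int.natCast_nonneg j) 3,
      pow_nonneg (Int.natCast_nonneg j) 4]

/-- The norm is monotone in `x1` and `y1`, which can be raised to `k`; convexity moves the other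
four coordinates to corners. -/
theorem crossNorm_le {k x1 x2 x3 y1 y2 y3 : ℤ} (hx1 : 0 ≤ x1 ∧ x1 ≤ k) (hx2 : 0 ≤ x2 ∧ x2 ≤ k)
    (hx3 : 0 ≤ x3 ∧ x3 ≤ k) (hy1 : 0 ≤ y1 ∧ y1 ≤ k) (hy2 : 0 ≤ y2 ∧ y2 ≤ k)
    (hy3 : 0 ≤ y3 ∧ y3 ≤ k) : crossNorm x1 x2 x3 y1 y2 y3 ≤ 8 * k ^ 4 := by
  have hk : 0 ≤ k := hx1.1.trans hx1.2
  have h1 : (x3 * y1 + x1 * y3) ^ 2 ≤ (k * y3 + k * x3) ^ 2 :=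
    pow_le_pow_left₀ (add_nonneg (mul_nonneg hx3.1 hy1.1) (mul_nonneg hx1.1 hy3.1))
      (by rw [add_comm, mul_comm x3]; exact add_le_add (mul_le_mul_of_nonneg_right hx1.2 hy3.1)
            (mul_le_mul_of_nonneg_right hy1.2 hx3.1)) 2
  have h2 : (x1 * y2 + x2 * y1) ^ 2 ≤ (k * y2 + k * x2) ^ 2 :=
    pow_le_pow_left₀ (add_nonneg (mul_nonneg hx1.1 hy2.1) (mul_nonneg hx2.1 hy1.1))
      (by rw [mul_comm x2]; exact add_le_add (mul_le_mul_of_nonneg_right hx1.2 hy2.1)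
            (mul_le_mul_of_nonneg_right hy1.2 hx2.1)) 2
  have h3 : crossNorm x1 x2 x3 y1 y2 y3 ≤ crossNorm k x2 x3 k y2 y3 := by
    unfold crossNorm; rw [mul_comm x2 k, mul_comm x3 k]; linarith
  have h4 : 0 ≤ k ^ 4 := by positivity
  -- The convexity lemmas are strict, so they are applied with the bound `8k⁴ + 1`.
  refine h3.trans (Int.lt_add_one_iff.mp ?_)
  refine crossNorm_lt_x2 hx2.1 hx2.2 ?_ ?_ <;> refine crossNorm_lt_x3 hx3.1 hx3.2 ?_ ?_ <;>
    refine crossNorm_lt_y2 hy2.1 hy2.2 ?_ ?_ <;> refine crossNorm_lt_y3 hy3.1 hy3.2 ?_ ?_ <;>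
    (unfold crossNorm; ring_nf; linarith)

theorem four_le_sq {n : ℤ} (h0 : n ≠ 0) (h1 : ¬(n = 1 ∨ n = -1)) : 4 ≤ n ^ 2 := by
  rcases lt_or_gt_of_ne h0 with h | h
  · have : n ≤ -2 := by omega
    nlinarith
  · have : 2 ≤ n := by omega
    nlinarith

/-! ### The bound for all pairs of lattice segments -/

theorem segmentBound_of_lt {k : ℕ} {p p' q q' : Fin 3 → ℤ}
    (h : crossSq (p' - p) (q' - q) < bound k) : SegmentBound k p p' q q' := by
  intro h0
  left
  have : 0 < vol (p' - p) (q' - q) (p - q) ^ 2 := by positivity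
  have hb := bound_pos k
  nlinarith

/-- Both directions are themselves points of the cube, so together with the origin they span a
triangle in it. -/
theorem segmentBound_of_nonneg {k : ℕ} (hk : 0 < k) {p p' q q' : Fin 3 → ℤ} (hp : InBox k p)
    (hp' : InBox k p') (hq : InBox k q) (hq' : InBox k q') (hu : ∀ i, p i ≤ p' i)
    (hv : ∀ i, q i ≤ q' i) : SegmentBound k p p' q q' := by
  refine segmentBound_of_lt (lt_of_le_of_lt ?_ (three_mul_pow_lt_bound hk))
  have h := crossSq_triangle_le (k := k) (a := 0) (b := p' - p) (c := q' - q)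
    (fun i => by simp) (fun i => ?_) fun i => ?_
  · simpa using h
  · have := hp i; have := hp' i; have := hu i
    simp only [Pi.sub_apply]; omega
  · have := hq i; have := hq' i; have := hv i
    simp only [Pi.sub_apply]; omega

theorem swap_apply_zero : Equiv.swap (1 : Fin 3) 2 0 = 0 := by decide
theorem swap_apply_one : Equiv.swap (1 : Fin 3) 2 1 = 2 := by decide
theorem swap_apply_two : Equiv.swap (1 : Fin 3) 2 2 = 1 := by decide

theorem latReflection_zero_zero (k : ℕ) (p : Fin 3 → ℤ) : latReflection k 0 p 0 = k - p 0 := rfl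
theorem latReflection_zero_one (k : ℕ) (p : Fin 3 → ℤ) : latReflection k 0 p 1 = p 1 := rfl
theorem latReflection_zero_two (k : ℕ) (p : Fin 3 → ℤ) : latReflection k 0 p 2 = p 2 := rfl

/-- A defect zero means that the segment crosses the whole cube in that coordinate, which fixes its
ends; the offset then locates the other segment. In every exceptional configuration each coordinate
has such a defect. -/
theorem offsets_eq {k p p' q q' a b e : ℤ} (hp : 0 ≤ p ∧ p ≤ k) (hp' : 0 ≤ p' ∧ p' ≤ k)
    (hq : 0 ≤ q ∧ q ≤ k) (hq' : 0 ≤ q' ∧ q' ≤ k) (h : p' - p = k - a) (h' : q' - q = k - b)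
    (he : p - q' + k = e) :
    if a = 0 then p = 0 ∧ p' = k ∧ q = b - e ∧ q' = k - e else
      b = 0 → p = e ∧ p' = k - a + e ∧ q = 0 ∧ q' = k := by
  split_ifs with ha
  · subst ha; refine ⟨?_, ?_, ?_, ?_⟩ <;> omega
  · rintro rfl; refine ⟨?_, ?_, ?_, ?_⟩ <;> omega

theorem isStarPair_of_exceptional {k : ℕ} {p p' q q' : Fin 3 → ℤ} (hp : InBox k p)
    (hp' : InBox k p') (hq : InBox k q) (hq' : InBox k q')
    {a1 a2 a3 b1 b2 b3 e1 e2 e3 : ℕ} (h1 : p 0 - p' 0 = k - a1) (h2 : p' 1 - p 1 = k - a2)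
    (h3 : p' 2 - p 2 = k - a3) (h4 : q' 0 - q 0 = k - b1) (h5 : q' 1 - q 1 = k - b2)
    (h6 : q' 2 - q 2 = k - b3) (h7 : p' 0 - q' 0 + k = e1) (h8 : p 1 - q' 1 + k = e2)
    (h9 : p 2 - q' 2 + k = e3) (h : Exceptional a1 a2 a3 b1 b2 b3 e1 e2 e3) :
    IsStarPair k (latSegment p p') (latSegment q q') := by
  -- The ends of the first segment are exchanged because it descends in coordinate `0`.
  have c0 := offsets_eq (hp' 0) (hp 0) (hq 0) (hq' 0) h1 h4 h7
  have c1 := offsets_eq (hp 1) (hp' 1) (hq 1) (hq' 1) h2 h5 h8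
  have c2 := offsets_eq (hp 2) (hp' 2) (hq 2) (hq' 2) h3 h6 h9
  clear hp hp' hq hq' h1 h2 h3 h4 h5 h6 h7 h8 h9
  simp only [Exceptional, List.mem_cons, List.cons.injEq, List.not_mem_nil, or_false,
    and_true] at h
  rcases h with h | h | h | h | h | h | h | h <;>
    obtain ⟨rfl, rfl, rfl, rfl, rfl, rfl, rfl, rfl, rfl⟩ := h <;>
    norm_num at c0 c1 c2 <;>
    obtain ⟨c00, c01, c02, c03⟩ := c0 <;> obtain ⟨c10, c11, c12, c13⟩ := c1 <;>
    obtain ⟨c20, c21, c22, c23⟩ := c2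
  · refine .of_swap 1 2 (isStarPair_of_eq_center ?_ ?_ ?_ ?_) <;>
      simp only [Function.comp_apply, swap_apply_zero, swap_apply_one, swap_apply_two] <;> refine ⟨?_, ?_, ?_⟩ <;> linarith
  · refine .of_swap 1 2 (isStarPair_of_eq ?_ ?_ ?_ ?_) <;>
      simp only [Function.comp_apply, swap_apply_zero, swap_apply_one, swap_apply_two] <;> refine ⟨?_, ?_, ?_⟩ <;> linarith
  · refine isStarPair_of_eq_center ?_ ?_ ?_ ?_ <;> refine ⟨?_, ?_, ?_⟩ <;> linarith
  · refine isStarPair_of_eq ?_ ?_ ?_ ?_ <;> refine ⟨?_, ?_, ?_⟩ <;> linarith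
  · refine .symm (.of_latReflection 0 (.of_swap 1 2 (isStarPair_of_eq_center ?_ ?_ ?_ ?_))) <;>
      simp only [Function.comp_apply, swap_apply_zero, swap_apply_one, swap_apply_two,
        latReflection_zero_zero, latReflection_zero_one, latReflection_zero_two] <;> refine ⟨?_, ?_, ?_⟩ <;> linarith
  · refine .symm (.of_latReflection 0 (.of_swap 1 2 (isStarPair_of_eq ?_ ?_ ?_ ?_))) <;>
      simp only [Function.comp_apply, swap_apply_zero, swap_apply_one, swap_apply_two,
        latReflection_zero_zero, latReflection_zero_one, latReflection_zero_two] <;> refine ⟨?_, ?_, ?_⟩ <;> linarith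
  · refine .symm (.of_latReflection 0 (isStarPair_of_eq_center ?_ ?_ ?_ ?_)) <;>
      simp only [latReflection_zero_zero, latReflection_zero_one, latReflection_zero_two] <;> refine ⟨?_, ?_, ?_⟩ <;> linarith
  · refine .symm (.of_latReflection 0 (isStarPair_of_eq ?_ ?_ ?_ ?_)) <;>
      simp only [latReflection_zero_zero, latReflection_zero_one, latReflection_zero_two] <;> refine ⟨?_, ?_, ?_⟩ <;> linarith

theorem segmentBound_of_normal {k : ℕ} (hk : 0 < k) (hk3 : k ≠ 3) {p p' q q' : Fin 3 → ℤ}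
    (hp : InBox k p) (hp' : InBox k p') (hq : InBox k q) (hq' : InBox k q') (hu0 : p' 0 ≤ p 0)
    (hu1 : p 1 ≤ p' 1) (hu2 : p 2 ≤ p' 2) (hv : ∀ i, q i ≤ q' i) : SegmentBound k p p' q q' := by
  have := hp 0; have := hp 1; have := hp 2
  have := hp' 0; have := hp' 1; have := hp' 2
  have := hq 0; have := hq 1; have := hq 2
  have := hq' 0; have := hq' 1; have := hq' 2
  have := hv 0; have := hv 1; have := hv 2
  obtain ⟨x1, hx1⟩ := Int.eq_ofNat_of_zero_le (sub_nonneg.mpr hu0)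
  obtain ⟨x2, hx2⟩ := Int.eq_ofNat_of_zero_le (sub_nonneg.mpr hu1)
  obtain ⟨x3, hx3⟩ := Int.eq_ofNat_of_zero_le (sub_nonneg.mpr hu2)
  obtain ⟨y1, hy1⟩ := Int.eq_ofNat_of_zero_le (sub_nonneg.mpr (hv 0))
  obtain ⟨y2, hy2⟩ := Int.eq_ofNat_of_zero_le (sub_nonneg.mpr (hv 1))
  obtain ⟨y3, hy3⟩ := Int.eq_ofNat_of_zero_le (sub_nonneg.mpr (hv 2))
  -- The offsets equal `p' 0 - q' 0 + k`, `p 1 - q' 1 + k` and `p 2 - q' 2 + k`: lower end of the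
  -- first segment against upper end of the second, shifted by `k` to be natural numbers.
  obtain ⟨e1, he1⟩ := Int.eq_ofNat_of_zero_le (show 0 ≤ p 0 - q 0 + k - x1 - y1 by omega)
  obtain ⟨e2, he2⟩ := Int.eq_ofNat_of_zero_le (show 0 ≤ p 1 - q 1 + k - y2 by omega)
  obtain ⟨e3, he3⟩ := Int.eq_ofNat_of_zero_le (show 0 ≤ p 2 - q 2 + k - y3 by omega)
  have hc : crossSq (p' - p) (q' - q) = crossNorm x1 x2 x3 y1 y2 y3 := by
    rw [← hx1, ← hx2, ← hx3, ← hy1, ← hy2, ← hy3]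
    simp only [crossSq, crossNorm, Pi.sub_apply]; ring
  have hV : vol (p' - p) (q' - q) (p - q) = normalVol k x1 x2 x3 y1 y2 y3 e1 e2 e3 := by
    rw [← he1, ← he2, ← he3, ← hx1, ← hx2, ← hx3, ← hy1, ← hy2, ← hy3]
    simp only [vol, normalVol, Pi.sub_apply]; ring
  intro h0
  -- A determinant of absolute value at least `2` contributes a factor `4`, which beats the crude
  -- bound `8k⁴`.
  by_cases hD : normalVol k x1 x2 x3 y1 y2 y3 e1 e2 e3 = 1 ∨
      normalVol k x1 x2 x3 y1 y2 y3 e1 e2 e3 = -1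
  · have hD2 : vol (p' - p) (q' - q) (p - q) ^ 2 = 1 := by
      rw [hV]; rcases hD with h | h <;> rw [h] <;> rfl
    rw [hD2, mul_one, hc]
    refine (optimal hk hk3 (by omega) (by omega) (by omega) (by omega) (by omega) (by omega)
      (by omega) (by omega) (by omega) hD).imp_right fun h => ⟨h.1, fun h4 => ?_⟩
    exact isStarPair_of_exceptional hp hp' hq hq' (by omega) (by omega) (by omega) (by omega)
      (by omega) (by omega) (by omega) (by omega) (by omega) (h.2 h4)
  · left
    rw [hV] at h0 ⊢
    rw [hc]
    have h2 := four_le_sq h0 hD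
    have h3 := crossNorm_le (k := k) (x1 := x1) (x2 := x2) (x3 := x3) (y1 := y1) (y2 := y2)
      (y3 := y3) (by omega) (by omega) (by omega) (by omega) (by omega) (by omega)
    have h4 := eight_mul_pow_lt_bound hk
    have h5 := mul_le_mul_of_nonneg_left h2 (bound_pos k).le
    linarith

/-- After a possible reversal of the first segment at most one of its coordinates decreases; an
exchange of coordinates makes it the coordinate `0`. -/
theorem segmentBound_of_le {k : ℕ} (hk : 0 < k) (hk3 : k ≠ 3) {p p' q q' : Fin 3 → ℤ}
    (hp : InBox k p) (hp' : InBox k p') (hq : InBox k q) (hq' : InBox k q')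
    (hv : ∀ i, q i ≤ q' i) : SegmentBound k p p' q q' := by
  have key : ∀ {r r' : Fin 3 → ℤ}, InBox k r → InBox k r' → ∀ i, (∀ j, j ≠ i → r j ≤ r' j) →
      SegmentBound k r r' q q' := by
    intro r r' hr hr' i h
    rcases le_total (r i) (r' i) with hi | hi
    · refine segmentBound_of_nonneg hk hr hr' hq hq' (fun j => ?_) hv
      by_cases hj : j = i
      · exact hj ▸ hi
      · exact h j hj
    · refine .of_swap 0 i (segmentBound_of_normal hk hk3 (hr.comp _) (hr'.comp _) (hq.comp _)
        (hq'.comp _) ?_ ?_ ?_ fun j => hv _)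
      · simpa using hi
      · exact h _ fun h' => absurd ((Equiv.swap_apply_eq_iff).mp h') (by simp)
      · exact h _ fun h' => absurd ((Equiv.swap_apply_eq_iff).mp h') (by simp)
  rcases le_total (p 0) (p' 0) with h0 | h0 <;> rcases le_total (p 1) (p' 1) with h1 | h1 <;>
    rcases le_total (p 2) (p' 2) with h2 | h2
  · exact key hp hp' 0 (by intro j hj; fin_cases j <;> simp_all)
  · exact key hp hp' 2 (by intro j hj; fin_cases j <;> simp_all)
  · exact key hp hp' 1 (by intro j hj; fin_cases j <;> simp_all)
  · exact .of_reverse (key hp' hp 0 (by intro j hj; fin_cases j <;> simp_all))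
  · exact key hp hp' 0 (by intro j hj; fin_cases j <;> simp_all)
  · exact .of_reverse (key hp' hp 1 (by intro j hj; fin_cases j <;> simp_all))
  · exact .of_reverse (key hp' hp 2 (by intro j hj; fin_cases j <;> simp_all))
  · exact .of_reverse (key hp' hp 0 (by intro j hj; fin_cases j <;> simp_all))

/-- Reflections orient the second segment one coordinate at a time; the set `S` records the
coordinates already increasing. -/
theorem segmentBound {k : ℕ} (hk : 0 < k) (hk3 : k ≠ 3) {p p' q q' : Fin 3 → ℤ}
    (hp : InBox k p) (hp' : InBox k p') (hq : InBox k q) (hq' : InBox k q') :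
    SegmentBound k p p' q q' := by
  have orient : ∀ (i : Fin 3) (S : Set (Fin 3)), (∀ {r r' s s' : Fin 3 → ℤ}, InBox k r →
      InBox k r' → InBox k s → InBox k s' → (∀ j, j ∈ insert i S → s j ≤ s' j) →
      SegmentBound k r r' s s') → ∀ {r r' s s' : Fin 3 → ℤ}, InBox k r →
      InBox k r' → InBox k s → InBox k s' → (∀ j ∈ S, s j ≤ s' j) →
      SegmentBound k r r' s s' := by
    intro i S h r r' s s' hr hr' hs hs' hS
    by_cases hi : s i ≤ s' i
    · refine h hr hr' hs hs' fun j hj => ?_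
      rcases hj with rfl | hj
      · exact hi
      · exact hS j hj
    · refine .of_latReflection i (h (hr.latReflection i) (hr'.latReflection i)
        (hs.latReflection i) (hs'.latReflection i) fun j hj => ?_)
      unfold latReflection
      split_ifs with hji
      · subst hji; omega
      · exact hS j (hj.resolve_left hji)
  refine orient 0 ∅ (orient 1 (insert 0 ∅) (orient 2 (insert 1 (insert 0 ∅))
    fun hr hr' hs hs' h => segmentBound_of_le hk hk3 hr hr' hs hs' fun j => h j ?_))
    hp hp' hq hq' (by simp)
  fin_cases j <;> simp

/-! ### Closest points and Carathéodory's theorem -/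

-- Project the origin to the compact convex set `P - Q`; the variational inequality of the
-- projection, with one of the two points held fixed, gives the two supporting planes.
open scoped Pointwise in
theorem exists_closest {d : ℕ} {P Q : Set (EuclideanSpace ℝ (Fin d))} (hP : IsCompact P)
    (hQ : IsCompact Q) (hPc : Convex ℝ P) (hQc : Convex ℝ Q) (hP0 : P.Nonempty)
    (hQ0 : Q.Nonempty) : ∃ p ∈ P, ∃ q ∈ Q, setDist P Q = ‖p - q‖ ∧
      (∀ x ∈ P, inner ℝ (p - q) p ≤ inner ℝ (p - q) x) ∧
      ∀ y ∈ Q, inner ℝ (p - q) y ≤ inner ℝ (p - q) q := by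
  have hc : Convex ℝ (P - Q) := hPc.sub hQc
  obtain ⟨z, hz, hmin⟩ := exists_norm_eq_iInf_of_complete_convex (hP0.sub hQ0)
    (by rw [sub_eq_add_neg]; exact (hP.add hQ.neg).isComplete) hc 0
  rw [norm_eq_iInf_iff_real_inner_le_zero hc hz] at hmin
  obtain ⟨p, hp, q, hq, rfl⟩ := Set.mem_sub.mp hz
  have key : ∀ x ∈ P, ∀ y ∈ Q, inner ℝ (p - q) (p - q) ≤ inner ℝ (p - q) (x - y) := by
    intro x hx y hy
    have := hmin (x - y) (Set.sub_mem_sub hx hy)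
    rw [zero_sub, inner_neg_left, inner_sub_right] at this
    linarith
  refine ⟨p, hp, q, hq, ?_, fun x hx => ?_, fun y hy => ?_⟩
  · refine IsLeast.csInf_eq ⟨⟨p, hp, q, hq, dist_eq_norm p q⟩, ?_⟩
    rintro _ ⟨x, hx, y, hy, rfl⟩
    rw [dist_eq_norm]
    have h := (key x hx y hy).trans (real_inner_le_norm _ _)
    rw [real_inner_self_eq_norm_sq, sq] at h
    by_contra! hlt
    nlinarith [norm_nonneg (p - q), norm_nonneg (x - y)]
  · have := key x hx q hq
    rw [inner_sub_right _ p, inner_sub_right _ x] at this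
    linarith
  · have := key p hp y hy
    rw [inner_sub_right _ p, inner_sub_right _ p] at this
    linarith

section caratheodory
variable {E : Type*} [AddCommGroup E] [Module ℝ E] {ι : Type*}

theorem sum_smul_mem_convexHull_image {I : Finset ι} {c : ι → ℝ} {f : ι → E}
    (hc : ∀ i ∈ I, 0 ≤ c i) (h1 : ∑ i ∈ I, c i = 1) :
    ∑ i ∈ I, c i • f i ∈ convexHull ℝ (f '' (I : Set ι)) :=
  (convex_convexHull ℝ _).sum_mem hc h1 fun _ hi =>
    subset_convexHull ℝ _ (Set.mem_image_of_mem f hi)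

theorem exists_triangle {I : Finset ι} (hI : I.Nonempty) (hI3 : I.card ≤ 3) {f : ι → E} {a : E}
    (ha : a ∈ convexHull ℝ (f '' (I : Set ι))) :
    ∃ i ∈ I, ∃ j ∈ I, ∃ l ∈ I, a ∈ convexHull ℝ {f i, f j, f l} := by
  classical
  have h1 : 1 ≤ I.card := hI.card_pos
  interval_cases hcard : I.card
  · obtain ⟨i, rfl⟩ := Finset.card_eq_one.mp hcard
    exact ⟨i, by simp, i, by simp, i, by simp, by simpa using ha⟩
  · obtain ⟨i, j, -, rfl⟩ := Finset.card_eq_two.mp hcard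
    exact ⟨i, by simp, i, by simp, j, by simp, by simpa [Set.image_pair] using ha⟩
  · obtain ⟨i, j, l, -, -, -, rfl⟩ := Finset.card_eq_three.mp hcard
    exact ⟨i, by simp, j, by simp, l, by simp, by simpa [Set.image_insert_eq] using ha⟩

theorem exists_segment {I : Finset ι} (hI : I.Nonempty) (hI2 : I.card ≤ 2) {f : ι → E} {a : E}
    (ha : a ∈ convexHull ℝ (f '' (I : Set ι))) :
    ∃ i ∈ I, ∃ j ∈ I, a ∈ segment ℝ (f i) (f j) := by
  classical
  have h1 : 1 ≤ I.card := hI.card_pos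
  interval_cases hcard : I.card
  · obtain ⟨i, rfl⟩ := Finset.card_eq_one.mp hcard
    exact ⟨i, by simp, i, by simp, by simpa using ha⟩
  · obtain ⟨i, j, -, rfl⟩ := Finset.card_eq_two.mp hcard
    exact ⟨i, by simp, j, by simp, by simpa [Set.image_pair, convexHull_pair] using ha⟩

theorem exists_vertex {I : Finset ι} (hI : I.Nonempty) (hI1 : I.card ≤ 1) {f : ι → E} {a : E}
    (ha : a ∈ convexHull ℝ (f '' (I : Set ι))) : ∃ i ∈ I, a = f i := by
  obtain ⟨i, rfl⟩ := Finset.card_eq_one.mp (le_antisymm hI1 hI.card_pos)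
  exact ⟨i, by simp, by simpa using ha⟩

end caratheodory

/-- Carathéodory's theorem for the points of two parallel supporting planes. -/
theorem exists_small_faces.{u} {E : Type u} [NormedAddCommGroup E] [InnerProductSpace ℝ E]
    (hE : Module.finrank ℝ E = 3) {S T : Set E} {p q : E} (hp : p ∈ convexHull ℝ S)
    (hq : q ∈ convexHull ℝ T) (hpq : p - q ≠ 0)
    (hS : ∀ x ∈ S, inner ℝ (p - q) p ≤ inner ℝ (p - q) x)
    (hT : ∀ y ∈ T, inner ℝ (p - q) y ≤ inner ℝ (p - q) q) :
    ∃ (ι : Type u) (I J : Finset ι) (f g : ι → E), I.Nonempty ∧ J.Nonempty ∧ I.card + J.card ≤ 4 ∧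
      (∀ i ∈ I, f i ∈ S ∧ inner ℝ (p - q) (f i) = inner ℝ (p - q) p) ∧
      (∀ j ∈ J, g j ∈ T ∧ inner ℝ (p - q) (g j) = inner ℝ (p - q) q) ∧
      ∃ a ∈ convexHull ℝ (f '' (I : Set ι)), ∃ b ∈ convexHull ℝ (g '' (J : Set ι)), a - b = p - q := by
  have hfd : FiniteDimensional ℝ E := FiniteDimensional.of_finrank_pos (by omega)
  set z := p - q with hz
  set A := inner ℝ z p with hA
  set B := inner ℝ z q with hB
  -- Cayley's trick: with `S` at height `0` and `-T` at height `1`, the point `(z / 2, 1 / 2)` of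
  -- the hull encodes the difference `p - q`.
  let X : Set (E × ℝ) := (fun x => (x, (0 : ℝ))) '' S ∪ (fun y => (-y, (1 : ℝ))) '' T
  have hp' : (p, (0 : ℝ)) ∈ convexHull ℝ X := by
    have h : convexHull ℝ ((LinearMap.inl ℝ E ℝ) '' S) ⊆ convexHull ℝ X :=
      convexHull_mono (by rintro _ ⟨x, hx, rfl⟩; exact Or.inl ⟨x, hx, rfl⟩)
    rw [← LinearMap.image_convexHull] at h
    exact h ⟨p, hp, rfl⟩
  have hq' : (-q, (1 : ℝ)) ∈ convexHull ℝ X := by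
    let N : E →ᵃ[ℝ] E × ℝ := (-LinearMap.inl ℝ E ℝ).toAffineMap + AffineMap.const ℝ E (0, 1)
    have hN : ∀ y, N y = (-y, 1) := fun y => by simp [N]
    have h : convexHull ℝ (N '' T) ⊆ convexHull ℝ X :=
      convexHull_mono (by rintro _ ⟨y, hy, rfl⟩; rw [hN]; exact Or.inr ⟨y, hy, rfl⟩)
    rw [← AffineMap.image_convexHull] at h
    exact h ⟨q, hq, hN q⟩
  have hmid : (1 / 2 : ℝ) • (p, (0 : ℝ)) + (1 / 2 : ℝ) • (-q, (1 : ℝ)) ∈ convexHull ℝ X :=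
    convex_convexHull ℝ X hp' hq' (by norm_num) (by norm_num) (by norm_num)
  obtain ⟨ι, _, y, w, hy, hind, hw, hw1, hsum⟩ := eq_pos_convex_span_of_mem_convexHull hmid
  -- The slope `A + B` in the height makes both supporting planes the same level: `L ≥ A` on all of
  -- `X`, with equality at the midpoint, hence at every point of positive weight.
  let L : E × ℝ →ₗ[ℝ] ℝ :=
    (innerₛₗ ℝ z).comp (LinearMap.fst ℝ E ℝ) + (A + B) • LinearMap.snd ℝ E ℝ
  have hL : ∀ x, L x = inner ℝ z x.1 + (A + B) * x.2 := fun x => by simp [L]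
  have hyX : ∀ i, y i ∈ X := fun i => hy ⟨i, rfl⟩
  have hge : ∀ i, A ≤ L (y i) := by
    intro i
    rcases hyX i with ⟨x, hx, h⟩ | ⟨x, hx, h⟩
    · rw [hL, ← h]; simpa using hS x hx
    · rw [hL, ← h]
      have := hT x hx
      simp only [inner_neg_right, mul_one]
      linarith
  have hLsum : ∑ i, w i * L (y i) = A := by
    have := congrArg L hsum
    rw [map_sum, hL] at this
    simp only [map_smul, smul_eq_mul] at this
    rw [this]
    simp [inner_add_right, inner_smul_right, ← hA, ← hB]
    ring
  have hLeq : ∀ i, L (y i) = A := by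
    have h0 : ∑ i, w i * (L (y i) - A) = 0 := by
      simp only [mul_sub, Finset.sum_sub_distrib, hLsum, ← Finset.sum_mul, hw1, one_mul, sub_self]
    rw [Finset.sum_eq_zero_iff_of_nonneg
      fun i _ => mul_nonneg (hw i).le (sub_nonneg.mpr (hge i))] at h0
    intro i
    exact sub_eq_zero.mp ((mul_eq_zero.mp (h0 i (Finset.mem_univ i))).resolve_left (hw i).ne')
  -- The points are affinely independent in a hyperplane of the four-dimensional `E × ℝ`.
  have hcard : Fintype.card ι ≤ 4 := by
    have hspan : vectorSpan ℝ (Set.range y) ≤ LinearMap.ker L := by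
      rw [vectorSpan_def, Submodule.span_le]
      rintro _ ⟨_, ⟨i, rfl⟩, _, ⟨j, rfl⟩, rfl⟩
      simp [hLeq]
    have hL0 : L ≠ 0 := by
      intro h
      have : L (z, 0) = 0 := by rw [h]; rfl
      rw [hL] at this
      exact hpq (by simpa using this)
    have h3 : Module.finrank ℝ (LinearMap.ker L) = 3 := by
      have := Module.Dual.finrank_ker_add_one_of_ne_zero hL0
      rw [Module.finrank_prod, hE, Module.finrank_self] at this
      omega
    have := hind.card_le_finrank_succ
    have := Submodule.finrank_mono hspan
    omega
  have hsnd : ∀ i, ((y i).2 = 0 ∧ (y i).1 ∈ S) ∨ ((y i).2 = 1 ∧ -(y i).1 ∈ T) := by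
    intro i
    rcases hyX i with ⟨x, hx, h⟩ | ⟨x, hx, h⟩
    · left; rw [← h]; exact ⟨rfl, hx⟩
    · right; rw [← h]; exact ⟨rfl, by simpa using hx⟩
  classical
  let I : Finset ι := Finset.univ.filter fun i => (y i).2 = 0
  let J : Finset ι := Finset.univ.filter fun i => ¬(y i).2 = 0
  have hJ1 : ∀ i ∈ J, (y i).2 = 1 := fun i hi =>
    ((hsnd i).resolve_left fun h => (Finset.mem_filter.mp hi).2 h.1).1
  -- The height of the midpoint is the total weight at height `1`. Each half of the weights is
  -- therefore doubled below.
  have hJw : ∑ i ∈ J, w i = 1 / 2 := by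
    have h := congrArg Prod.snd hsum
    rw [Prod.snd_sum, ← Finset.sum_filter_add_sum_filter_not _ fun i => (y i).2 = 0] at h
    rw [Finset.sum_eq_zero fun i hi => by simp [(Finset.mem_filter.mp hi).2],
      Finset.sum_congr rfl fun i hi => by rw [Prod.smul_snd, hJ1 i hi, smul_eq_mul, mul_one]] at h
    simpa using h
  have hIw : ∑ i ∈ I, w i = 1 / 2 := by
    have h := Finset.sum_filter_add_sum_filter_not Finset.univ (fun i => (y i).2 = 0) w
    rw [hw1, hJw] at h
    linarith
  refine ⟨ι, I, J, fun i => (y i).1, fun i => -(y i).1, ?_, ?_, ?_, ?_, ?_,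
    ∑ i ∈ I, (2 * w i) • (y i).1, ?_, ∑ i ∈ J, (2 * w i) • -(y i).1, ?_, ?_⟩
  · by_contra h
    rw [Finset.not_nonempty_iff_eq_empty.mp h] at hIw
    norm_num at hIw
  · by_contra h
    rw [Finset.not_nonempty_iff_eq_empty.mp h] at hJw
    norm_num at hJw
  · rwa [Finset.card_filter_add_card_filter_not, Finset.card_univ]
  · intro i hi
    have h0 := (Finset.mem_filter.mp hi).2
    have h := hLeq i
    rw [hL, h0] at h
    refine ⟨((hsnd i).resolve_right fun h => ?_).2, by linarith⟩
    rw [h0] at h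
    exact zero_ne_one h.1
  · intro i hi
    have h := hLeq i
    rw [hL, hJ1 i hi] at h
    refine ⟨((hsnd i).resolve_left fun h => (Finset.mem_filter.mp hi).2 h.1).2, ?_⟩
    rw [inner_neg_right]
    linarith
  · exact sum_smul_mem_convexHull_image (c := fun i => 2 * w i) (fun i _ => mul_nonneg zero_le_two (hw i).le)
      (by rw [← Finset.mul_sum, hIw]; norm_num)
  · exact sum_smul_mem_convexHull_image (c := fun i => 2 * w i) (f := fun i => -(y i).1)
      (fun i _ => mul_nonneg zero_le_two (hw i).le) (by rw [← Finset.mul_sum, hJw]; norm_num)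
  · have h := congrArg Prod.fst hsum
    rw [Prod.fst_sum, ← Finset.sum_filter_add_sum_filter_not _ fun i => (y i).2 = 0] at h
    simp only [smul_neg, Finset.sum_neg_distrib, sub_neg_eq_add, mul_smul, ← Finset.smul_sum,
      ← smul_add]
    simp only [Prod.smul_fst] at h
    rw [h]
    simp [hz, smul_smul, sub_eq_add_neg]

/-! ### The lower bound on the distance -/

theorem latticePoint_apply {d : ℕ} (p : Fin d → ℤ) (i : Fin d) : latticePoint p i = p i := rfl

theorem inner_fin_three (z x : EuclideanSpace ℝ (Fin 3)) :
    inner ℝ z x = z 0 * x 0 + z 1 * x 1 + z 2 * x 2 := by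
  simp [PiLp.inner_apply, Fin.sum_univ_three]; ring

theorem norm_sq_fin_three (z : EuclideanSpace ℝ (Fin 3)) :
    ‖z‖ ^ 2 = z 0 ^ 2 + z 1 ^ 2 + z 2 ^ 2 := by
  rw [← real_inner_self_eq_norm_sq, inner_fin_three]; ring

theorem cast_crossSq (u v : Fin 3 → ℤ) :
    ((crossSq u v : ℤ) : ℝ) = crossSq (fun i => (u i : ℝ)) fun i => (v i : ℝ) := by
  simp [crossSq]

/-- Lagrange's identity for `z` and `u × v`; the remaining term is the squared norm of `z × (u × v)
= (z · v)u - (z · u)v`, which vanishes. -/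
theorem norm_sq_mul_crossSq {z u v : Fin 3 → ℝ} (hu : z 0 * u 0 + z 1 * u 1 + z 2 * u 2 = 0)
    (hv : z 0 * v 0 + z 1 * v 1 + z 2 * v 2 = 0) :
    (z 0 ^ 2 + z 1 ^ 2 + z 2 ^ 2) * crossSq u v = vol u v z ^ 2 := by
  have h : (z 0 ^ 2 + z 1 ^ 2 + z 2 ^ 2) * crossSq u v = vol u v z ^ 2 +
      (u 0 * (z 0 * v 0 + z 1 * v 1 + z 2 * v 2) - v 0 * (z 0 * u 0 + z 1 * u 1 + z 2 * u 2)) ^ 2 +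
      (u 1 * (z 0 * v 0 + z 1 * v 1 + z 2 * v 2) - v 1 * (z 0 * u 0 + z 1 * u 1 + z 2 * u 2)) ^ 2 +
      (u 2 * (z 0 * v 0 + z 1 * v 1 + z 2 * v 2)
        - v 2 * (z 0 * u 0 + z 1 * u 1 + z 2 * u 2)) ^ 2 := by
    unfold crossSq vol; ring
  rw [h, hu, hv]; ring

theorem three_mul_sq_lt_bound {k : ℕ} (hk : 0 < k) : 3 * (k : ℤ) ^ 2 < bound k := by
  refine lt_of_le_of_lt ?_ (three_mul_pow_lt_bound hk)
  have : (1 : ℤ) ≤ k := by exact_mod_cast hk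
  linarith [pow_le_pow_right₀ this (show 2 ≤ 4 by norm_num)]

/-- Since `z` is orthogonal to `u`, `|z|² |u|² = |z × u|² = |m × u|²` is a positive integer, whereas
`|u|² ≤ 3k² < bound k`. -/
theorem one_lt_bound_mul_of_line {k : ℕ} (hk : 0 < k) {m u : Fin 3 → ℤ} (hu : ∀ i, |u i| ≤ k)
    (hu0 : u ≠ 0) {z : EuclideanSpace ℝ (Fin 3)} (hz : z ≠ 0)
    (hzu : z 0 * u 0 + z 1 * u 1 + z 2 * u 2 = 0)
    (hzm : crossSq z.ofLp (fun i => (u i : ℝ)) = (crossSq m u : ℤ)) : 1 < bound k * ‖z‖ ^ 2 := by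
  have hz2 : 0 < ‖z‖ ^ 2 := by positivity
  have hus : 0 < u 0 ^ 2 + u 1 ^ 2 + u 2 ^ 2 := by
    by_contra! h
    refine hu0 (funext fun i => ?_)
    have h0 : u 0 ^ 2 = 0 := by nlinarith [sq_nonneg (u 0), sq_nonneg (u 1), sq_nonneg (u 2)]
    have h1 : u 1 ^ 2 = 0 := by nlinarith [sq_nonneg (u 0), sq_nonneg (u 1), sq_nonneg (u 2)]
    have h2 : u 2 ^ 2 = 0 := by nlinarith [sq_nonneg (u 0), sq_nonneg (u 1), sq_nonneg (u 2)]
    fin_cases i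
    · exact pow_eq_zero_iff two_ne_zero |>.mp h0
    · exact pow_eq_zero_iff two_ne_zero |>.mp h1
    · exact pow_eq_zero_iff two_ne_zero |>.mp h2
  have hule : u 0 ^ 2 + u 1 ^ 2 + u 2 ^ 2 ≤ 3 * (k : ℤ) ^ 2 := by
    have h : ∀ i, u i ^ 2 ≤ (k : ℤ) ^ 2 := fun i => sq_le_sq.mpr (by simpa using hu i)
    linarith [h 0, h 1, h 2]
  have hb := three_mul_sq_lt_bound hk
  have key : ‖z‖ ^ 2 * ((u 0 ^ 2 + u 1 ^ 2 + u 2 ^ 2 : ℤ) : ℝ) = (crossSq m u : ℤ) := by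
    rw [← hzm, norm_sq_fin_three]
    push_cast
    have : (z 0 ^ 2 + z 1 ^ 2 + z 2 ^ 2) * ((u 0 : ℝ) ^ 2 + (u 1 : ℝ) ^ 2 + (u 2 : ℝ) ^ 2) =
      crossSq z.ofLp (fun i => (u i : ℝ)) + (z 0 * u 0 + z 1 * u 1 + z 2 * u 2) ^ 2 := by
      unfold crossSq; ring
    rw [this, hzu]; ring
  have hpos : (0 : ℝ) < (crossSq m u : ℤ) := by
    rw [← key]
    exact mul_pos hz2 (by exact_mod_cast hus)
  have h1 : (1 : ℝ) ≤ (crossSq m u : ℤ) := by exact_mod_cast (show 0 < crossSq m u by exact_mod_cast hpos)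
  rw [← key] at h1
  have h2 : ((u 0 ^ 2 + u 1 ^ 2 + u 2 ^ 2 : ℤ) : ℝ) < (bound k : ℤ) := by
    exact_mod_cast lt_of_le_of_lt hule hb
  nlinarith

/-- A vector orthogonal to two lattice vectors, and equal to a lattice vector modulo their span,
is either a multiple of their cross product or long. -/
theorem norm_sq_alternative {k : ℕ} (hk : 0 < k) {m u v : Fin 3 → ℤ} (hu : ∀ i, |u i| ≤ k)
    (hv : ∀ i, |v i| ≤ k) {z : EuclideanSpace ℝ (Fin 3)} (hz : z ≠ 0)
    (hzu : z 0 * u 0 + z 1 * u 1 + z 2 * u 2 = 0) (hzv : z 0 * v 0 + z 1 * v 1 + z 2 * v 2 = 0)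
    {s t : ℝ} (hzm : ∀ i, z i = m i + s * u i + t * v i) :
    (vol u v m ≠ 0 ∧ ‖z‖ ^ 2 * (crossSq u v : ℤ) = ((vol u v m : ℤ) : ℝ) ^ 2) ∨ 1 < bound k * ‖z‖ ^ 2 := by
  have hz2 : 0 < ‖z‖ ^ 2 := by positivity
  -- For parallel `u` and `v`, either both vanish and `z` is integral, or a nonzero one reduces the
  -- problem to a single line.
  by_cases hc : crossSq u v = 0
  · right
    have hc' : crossSq u v = (u 1 * v 2 - u 2 * v 1) ^ 2 + (u 2 * v 0 - u 0 * v 2) ^ 2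
      + (u 0 * v 1 - u 1 * v 0) ^ 2 := rfl
    have c0 : u 1 * v 2 - u 2 * v 1 = 0 := by
      refine pow_eq_zero_iff two_ne_zero |>.mp ?_
      nlinarith [sq_nonneg (u 1 * v 2 - u 2 * v 1), sq_nonneg (u 2 * v 0 - u 0 * v 2),
        sq_nonneg (u 0 * v 1 - u 1 * v 0)]
    have c1 : u 2 * v 0 - u 0 * v 2 = 0 := by
      refine pow_eq_zero_iff two_ne_zero |>.mp ?_
      nlinarith [sq_nonneg (u 1 * v 2 - u 2 * v 1), sq_nonneg (u 2 * v 0 - u 0 * v 2),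
        sq_nonneg (u 0 * v 1 - u 1 * v 0)]
    have c2 : u 0 * v 1 - u 1 * v 0 = 0 := by
      refine pow_eq_zero_iff two_ne_zero |>.mp ?_
      nlinarith [sq_nonneg (u 1 * v 2 - u 2 * v 1), sq_nonneg (u 2 * v 0 - u 0 * v 2),
        sq_nonneg (u 0 * v 1 - u 1 * v 0)]
    have d0 : (u 1 : ℝ) * v 2 - u 2 * v 1 = 0 := by exact_mod_cast c0
    have d1 : (u 2 : ℝ) * v 0 - u 0 * v 2 = 0 := by exact_mod_cast c1
    have d2 : (u 0 : ℝ) * v 1 - u 1 * v 0 = 0 := by exact_mod_cast c2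
    by_cases hu0 : u = 0
    · by_cases hv0 : v = 0
      · have hz' : ∀ i, z i = m i := fun i => by rw [hzm, hu0, hv0]; simp
        have h : ‖z‖ ^ 2 = ((m 0 ^ 2 + m 1 ^ 2 + m 2 ^ 2 : ℤ) : ℝ) := by
          rw [norm_sq_fin_three, hz', hz', hz']; push_cast; rfl
        rw [h] at hz2 ⊢
        have h1 : 1 ≤ m 0 ^ 2 + m 1 ^ 2 + m 2 ^ 2 := by exact_mod_cast hz2
        have h2 : 1 < bound k := by
          have := three_mul_sq_lt_bound hk
          have : (1 : ℤ) ≤ k := by exact_mod_cast hk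
          nlinarith
        have h3 : 1 < bound k * (m 0 ^ 2 + m 1 ^ 2 + m 2 ^ 2) := by nlinarith
        exact_mod_cast h3
      · refine one_lt_bound_mul_of_line (m := m) hk hv hv0 hz hzv ?_
        rw [cast_crossSq]
        unfold crossSq
        rw [hzm, hzm, hzm, hu0]
        simp; ring
    · refine one_lt_bound_mul_of_line (m := m) hk hu hu0 hz hzu ?_
      rw [cast_crossSq]
      have e0 : z 1 * u 2 - z 2 * u 1 = m 1 * u 2 - m 2 * u 1 := by
        rw [hzm, hzm]; linear_combination (-t) * d0
      have e1 : z 2 * u 0 - z 0 * u 2 = m 2 * u 0 - m 0 * u 2 := by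
        rw [hzm, hzm]; linear_combination (-t) * d1
      have e2 : z 0 * u 1 - z 1 * u 0 = m 0 * u 1 - m 1 * u 0 := by
        rw [hzm, hzm]; linear_combination (-t) * d2
      unfold crossSq
      rw [e0, e1, e2]
  · left
    -- The determinant with `u` and `v` only sees `z` modulo their span, where it agrees with `m`.
    have hvol : vol (fun i => (u i : ℝ)) (fun i => (v i : ℝ)) z.ofLp = (vol u v m : ℤ) := by
      unfold vol
      rw [hzm, hzm, hzm]
      push_cast; ring
    have h := norm_sq_mul_crossSq (z := z.ofLp) (u := fun i => (u i : ℝ)) (v := fun i => (v i : ℝ))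
      hzu hzv
    rw [← norm_sq_fin_three, ← cast_crossSq, hvol] at h
    refine ⟨fun h0 => ?_, h⟩
    rw [h0] at h
    have : ((crossSq u v : ℤ) : ℝ) ≠ 0 := by exact_mod_cast hc
    have := mul_ne_zero hz2.ne' this
    exact this (by simpa using h)

/-- The inequality is strict since `|u × v|² ≤ 3k⁴ < bound k` for the edges of a triangle in the
cube; a vertex and a triangle are never extremal. -/
theorem one_lt_bound_mul_of_triangle {k : ℕ} (hk : 0 < k) {m a b c : Fin 3 → ℤ} (ha : InBox k a)
    (hb : InBox k b) (hc : InBox k c) {z : EuclideanSpace ℝ (Fin 3)} (hz : z ≠ 0)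
    (hb' : inner ℝ z (latticePoint b) = inner ℝ z (latticePoint a))
    (hc' : inner ℝ z (latticePoint c) = inner ℝ z (latticePoint a))
    {x : EuclideanSpace ℝ (Fin 3)}
    (hx : x ∈ convexHull ℝ {latticePoint a, latticePoint b, latticePoint c})
    (hzx : z = latticePoint m - x ∨ z = x - latticePoint m) : 1 < bound k * ‖z‖ ^ 2 := by
  have hdiff : ∀ {p q : Fin 3 → ℤ}, InBox k p → InBox k q → ∀ i, |(p - q) i| ≤ k := by
    intro p q hp hq i
    have := hp i; have := hq i
    rw [Pi.sub_apply, abs_le]; omega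
  rw [convexHull_insert (by simp), convexHull_pair, convexJoin_singleton_left] at hx
  obtain ⟨y, ⟨r, s, hr, hs, hrs, rfl⟩, r', s', hr', hs', hrs', rfl⟩ := by simpa using hx
  have hu : z 0 * (b - a) 0 + z 1 * (b - a) 1 + z 2 * (b - a) 2 = 0 := by
    rw [inner_fin_three, inner_fin_three] at hb'
    simp only [latticePoint_apply] at hb'
    simp only [Pi.sub_apply, Int.cast_sub]; linarith
  have hv : z 0 * (c - a) 0 + z 1 * (c - a) 1 + z 2 * (c - a) 2 = 0 := by
    rw [inner_fin_three, inner_fin_three] at hc'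
    simp only [latticePoint_apply] at hc'
    simp only [Pi.sub_apply, Int.cast_sub]; linarith
  have key : ∃ (m' : Fin 3 → ℤ) (α β : ℝ),
      ∀ i, z i = m' i + α * ((b - a) i : ℤ) + β * ((c - a) i : ℤ) := by
    have h1 : r' = 1 - s' := by linarith
    have h2 : r = 1 - s := by linarith
    rcases hzx with h | h
    · refine ⟨m - a, -(s' * r), -(s' * s), fun i => ?_⟩
      rw [h]
      simp [latticePoint_apply, h1, h2]; ring
    · refine ⟨a - m, s' * r, s' * s, fun i => ?_⟩
      rw [h]
      simp [latticePoint_apply, h1, h2]; ring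
  obtain ⟨m', α, β, hm'⟩ := key
  rcases norm_sq_alternative hk (hdiff hb ha) (hdiff hc ha) hz hu hv hm' with ⟨h0, h⟩ | h
  · have h1 : ((crossSq (b - a) (c - a) : ℤ) : ℝ) < bound k := by
      exact_mod_cast lt_of_le_of_lt (crossSq_triangle_le ha hb hc) (three_mul_pow_lt_bound hk)
    have h2 : (1 : ℝ) ≤ ((vol (b - a) (c - a) m' : ℤ) : ℝ) ^ 2 := by
      exact_mod_cast (show 0 < vol (b - a) (c - a) m' ^ 2 by positivity)
    have hz2 : 0 < ‖z‖ ^ 2 := by positivity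
    nlinarith
  · exact h

theorem inBox_of_mem_cube {k : ℕ} {p : Fin 3 → ℤ} (h : latticePoint p ∈ cube 3 k) : InBox k p := by
  intro i
  have : (0 : ℝ) ≤ (p i : ℝ) ∧ (p i : ℝ) ≤ (k : ℝ) := h i
  exact ⟨by exact_mod_cast this.1, by exact_mod_cast this.2⟩

/-- The lower bound on the distance of two polytopes, with the case of equality. -/
theorem one_le_bound_mul_setDist_sq {k : ℕ} (hk : 0 < k) (hk3 : k ≠ 3)
    {P Q : Set (EuclideanSpace ℝ (Fin 3))} (hP : IsLatticeDKPolytope 3 k P)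
    (hQ : IsLatticeDKPolytope 3 k Q) (hPQ : Disjoint P Q) :
    1 ≤ bound k * setDist P Q ^ 2 ∧ (bound k * setDist P Q ^ 2 = 1 → 4 ≤ k →
      ∃ p p' q q' : Fin 3 → ℤ, latSegment p p' ⊆ P ∧ latSegment q q' ⊆ Q ∧
        IsStarPair k (latSegment p p') (latSegment q q')) := by
  obtain ⟨⟨V, hV, rfl⟩, hPc⟩ := hP
  obtain ⟨⟨W, hW, rfl⟩, hQc⟩ := hQ
  set S := latticePoint '' (V : Set (Fin 3 → ℤ)) with hS
  set T := latticePoint '' (W : Set (Fin 3 → ℤ)) with hT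
  have hSf : S.Finite := V.finite_toSet.image _
  have hTf : T.Finite := W.finite_toSet.image _
  have hS0 : S.Nonempty := (Finset.coe_nonempty.mpr hV).image _
  have hT0 : T.Nonempty := (Finset.coe_nonempty.mpr hW).image _
  obtain ⟨p, hp, q, hq, hd, hpm, hqm⟩ := exists_closest (hSf.isCompact_convexHull ℝ)
    (hTf.isCompact_convexHull ℝ) (convex_convexHull ℝ S) (convex_convexHull ℝ T)
    hS0.convexHull hT0.convexHull
  have hz : p - q ≠ 0 := fun h => by
    rw [sub_eq_zero.mp h] at hp
    exact Set.disjoint_left.mp hPQ hp hq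
  rw [hd]
  obtain ⟨ι, I, J, f, g, hI, hJ, hcard, hf, hg, a, ha, b, hb, hab⟩ :=
    exists_small_faces (by simp) hp hq hz (fun x hx => hpm x (subset_convexHull ℝ S hx))
      (fun y hy => hqm y (subset_convexHull ℝ T hy))
  have hbox : ∀ {R : Finset (Fin 3 → ℤ)},
      convexHull ℝ (latticePoint '' (R : Set (Fin 3 → ℤ))) ⊆ cube 3 k →
      ∀ x ∈ latticePoint '' (R : Set (Fin 3 → ℤ)), ∃ r, InBox k r ∧ latticePoint r = x := by
    rintro R hR _ ⟨r, hr, rfl⟩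
    exact ⟨r, inBox_of_mem_cube (hR (subset_convexHull ℝ _ ⟨r, hr, rfl⟩)), rfl⟩
  have hI1 := hI.card_pos
  have hJ1 := hJ.card_pos
  -- Both sets are nonempty and have at most four elements in all.
  have hcases : (I.card ≤ 2 ∧ J.card ≤ 2) ∨ (I.card ≤ 1 ∧ J.card ≤ 3) ∨
    (I.card ≤ 3 ∧ J.card ≤ 1) := by omega
  rcases hcases with ⟨h2, h2'⟩ | ⟨h1, h3⟩ | ⟨h3, h1⟩
  · obtain ⟨i, hi, i', hi', hai⟩ := exists_segment hI h2 ha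
    obtain ⟨j, hj, j', hj', hbj⟩ := exists_segment hJ h2' hb
    obtain ⟨r, hr, hri⟩ := hbox hPc _ (hf i hi).1
    obtain ⟨r', hr', hri'⟩ := hbox hPc _ (hf i' hi').1
    obtain ⟨s, hs, hsj⟩ := hbox hQc _ (hg j hj).1
    obtain ⟨s', hs', hsj'⟩ := hbox hQc _ (hg j' hj').1
    have hu : inner ℝ (p - q) (latticePoint r') = inner ℝ (p - q) (latticePoint r) := by
      rw [hri, hri', (hf i hi).2, (hf i' hi').2]
    have hv : inner ℝ (p - q) (latticePoint s') = inner ℝ (p - q) (latticePoint s) := by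
      rw [hsj, hsj', (hg j hj).2, (hg j' hj').2]
    rw [inner_fin_three, inner_fin_three] at hu hv
    simp only [latticePoint_apply] at hu hv
    have hPseg : latSegment r r' ⊆ convexHull ℝ S := by
      refine (convex_convexHull ℝ S).segment_subset ?_ ?_ <;> apply subset_convexHull ℝ S
      · rw [hri]; exact (hf i hi).1
      · rw [hri']; exact (hf i' hi').1
    have hQseg : latSegment s s' ⊆ convexHull ℝ T := by
      refine (convex_convexHull ℝ T).segment_subset ?_ ?_ <;> apply subset_convexHull ℝ T
      · rw [hsj]; exact (hg j hj).1
      · rw [hsj']; exact (hg j' hj').1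
    rw [← hri, ← hri', segment_eq_image'] at hai
    rw [← hsj, ← hsj', segment_eq_image'] at hbj
    obtain ⟨α, hα, rfl⟩ := hai
    obtain ⟨β, hβ, rfl⟩ := hbj
    have hdiff : ∀ {p q : Fin 3 → ℤ}, InBox k p → InBox k q → ∀ i, |(p - q) i| ≤ k := by
      intro p q hp hq i
      have := hp i; have := hq i
      rw [Pi.sub_apply, abs_le]; omega
    have key := norm_sq_alternative (z := p - q) (m := r - s) (u := r' - r) (v := s' - s) (s := α)
      (t := -β) hk (hdiff hr' hr) (hdiff hs' hs) hz
      (by simp only [Pi.sub_apply, Int.cast_sub]; linarith)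
      (by simp only [Pi.sub_apply, Int.cast_sub]; linarith)
      (fun i => by rw [← hab]; simp [latticePoint_apply]; ring)
    rcases key with ⟨h0, h⟩ | h
    · have hz2 : 0 < ‖p - q‖ ^ 2 := by positivity
      have hv2 : (0 : ℝ) < ((vol (r' - r) (s' - s) (r - s) : ℤ) : ℝ) ^ 2 := by positivity
      rcases segmentBound hk hk3 hr hr' hs hs' h0 with hlt | ⟨heq, hstar⟩
      · have hlt' : ((crossSq (r' - r) (s' - s) : ℤ) : ℝ) <
            bound k * ((vol (r' - r) (s' - s) (r - s) : ℤ) : ℝ) ^ 2 := by exact_mod_cast hlt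
        have h1 : 1 < bound k * ‖p - q‖ ^ 2 := by
          have := mul_lt_mul_of_pos_left hlt' hz2
          rw [h] at this
          nlinarith
        exact ⟨h1.le, fun he => absurd he h1.ne'⟩
      · have heq' : ((crossSq (r' - r) (s' - s) : ℤ) : ℝ) =
            bound k * ((vol (r' - r) (s' - s) (r - s) : ℤ) : ℝ) ^ 2 := by exact_mod_cast heq
        rw [heq'] at h
        have h1 : bound k * ‖p - q‖ ^ 2 = 1 := by
          refine mul_right_cancel₀ hv2.ne' ?_
          linarith
        exact ⟨h1.ge, fun _ h4 => ⟨r, r', s, s', hPseg, hQseg, hstar h4⟩⟩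
    · exact ⟨h.le, fun he => absurd he h.ne'⟩
  · obtain ⟨i, hi, rfl⟩ := exists_vertex hI h1 ha
    obtain ⟨j, hj, j', hj', j'', hj'', hbj⟩ := exists_triangle hJ h3 hb
    obtain ⟨r, -, hri⟩ := hbox hPc _ (hf i hi).1
    obtain ⟨s, hs, hsj⟩ := hbox hQc _ (hg j hj).1
    obtain ⟨s', hs', hsj'⟩ := hbox hQc _ (hg j' hj').1
    obtain ⟨s'', hs'', hsj''⟩ := hbox hQc _ (hg j'' hj'').1
    rw [← hsj, ← hsj', ← hsj''] at hbj
    have h := one_lt_bound_mul_of_triangle hk hs hs' hs'' hz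
      (by rw [hsj, hsj', (hg j hj).2, (hg j' hj').2])
      (by rw [hsj, hsj'', (hg j hj).2, (hg j'' hj'').2]) hbj (Or.inl (by rw [hri, hab]))
    exact ⟨h.le, fun he => absurd he h.ne'⟩
  · obtain ⟨i, hi, rfl⟩ := exists_vertex hJ h1 hb
    obtain ⟨j, hj, j', hj', j'', hj'', hbj⟩ := exists_triangle hI h3 ha
    obtain ⟨r, -, hri⟩ := hbox hQc _ (hg i hi).1
    obtain ⟨s, hs, hsj⟩ := hbox hPc _ (hf j hj).1
    obtain ⟨s', hs', hsj'⟩ := hbox hPc _ (hf j' hj').1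
    obtain ⟨s'', hs'', hsj''⟩ := hbox hPc _ (hf j'' hj'').1
    rw [← hsj, ← hsj', ← hsj''] at hbj
    have h := one_lt_bound_mul_of_triangle hk hs hs' hs'' hz
      (by rw [hsj, hsj', (hf j hj).2, (hf j' hj').2])
      (by rw [hsj, hsj'', (hf j hj).2, (hf j'' hj'').2]) hbj (Or.inr (by rw [hri, hab]))
    exact ⟨h.le, fun he => absurd he h.ne'⟩

/-! ### Attainment of the bound -/

theorem convex_cube (d k : ℕ) : Convex ℝ (cube d k) := by
  intro x hx y hy a b ha hb hab i
  exact convex_Icc (0 : ℝ) k (hx i) (hy i) ha hb hab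

theorem InBox.latticePoint_mem_cube {k : ℕ} {p : Fin 3 → ℤ} (h : InBox k p) :
    latticePoint p ∈ cube 3 k := by
  intro i
  have := h i
  change (0 : ℝ) ≤ (p i : ℝ) ∧ (p i : ℝ) ≤ (k : ℝ)
  exact ⟨by exact_mod_cast this.1, by exact_mod_cast this.2⟩

theorem isLatticeDKPolytope_latSegment {k : ℕ} {p p' : Fin 3 → ℤ} (hp : InBox k p)
    (hp' : InBox k p') : IsLatticeDKPolytope 3 k (latSegment p p') := by
  refine ⟨⟨{p, p'}, by simp, ?_⟩, (convex_cube 3 k).segment_subset hp.latticePoint_mem_cube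
    hp'.latticePoint_mem_cube⟩
  rw [Finset.coe_pair, Set.image_pair, convexHull_pair, latSegment]

/-- The inner product of two integer vectors. -/
def dot (u v : Fin 3 → ℤ) : ℤ := u 0 * v 0 + u 1 * v 1 + u 2 * v 2

theorem le_setDist {k : ℕ} (hk : 0 < k) (hk3 : k ≠ 3)
    {P Q : Set (EuclideanSpace ℝ (Fin 3))} (hP : IsLatticeDKPolytope 3 k P)
    (hQ : IsLatticeDKPolytope 3 k Q) (hPQ : Disjoint P Q) :
    1 / √(bound k) ≤ setDist P Q := by
  have h := (one_le_bound_mul_setDist_sq hk hk3 hP hQ hPQ).1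
  have h0 : 0 ≤ setDist P Q := by
    refine Real.sInf_nonneg ?_
    rintro _ ⟨x, -, y, -, rfl⟩
    exact dist_nonneg
  have hb : (0 : ℝ) < bound k := by exact_mod_cast bound_pos k
  rw [div_le_iff₀ (Real.sqrt_pos.mpr hb)]
  rw [← abs_of_nonneg (mul_nonneg h0 (Real.sqrt_nonneg _)), ← one_le_sq_iff_one_le_abs, mul_pow,
    Real.sq_sqrt hb.le]
  linarith

/-- Two lattice segments that cross at lattice distance `1` and reach the lower bound. -/
theorem setDist_latSegment {k : ℕ} (hk : 0 < k) (hk3 : k ≠ 3) {p p' q q' : Fin 3 → ℤ}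
    (hp : InBox k p) (hp' : InBox k p') (hq : InBox k q) (hq' : InBox k q')
    (hc : crossSq (p' - p) (q' - q) = bound k) (hv : vol (p' - p) (q' - q) (p - q) ^ 2 = 1)
    (hs : 0 ≤ dot (p - q) (q' - q) * dot (p' - p) (q' - q)
      - dot (p - q) (p' - p) * dot (q' - q) (q' - q))
    (hs' : dot (p - q) (q' - q) * dot (p' - p) (q' - q)
      - dot (p - q) (p' - p) * dot (q' - q) (q' - q) ≤ bound k)
    (ht : 0 ≤ dot (p - q) (q' - q) * dot (p' - p) (p' - p)
      - dot (p - q) (p' - p) * dot (p' - p) (q' - q))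
    (ht' : dot (p - q) (q' - q) * dot (p' - p) (p' - p)
      - dot (p - q) (p' - p) * dot (p' - p) (q' - q) ≤ bound k) :
    Disjoint (latSegment p p') (latSegment q q') ∧
      setDist (latSegment p p') (latSegment q q') = 1 / √(bound k) := by
  have hbZ := bound_pos k
  have hb : (0 : ℝ) < (bound k : ℤ) := by exact_mod_cast hbZ
  have hdisj : Disjoint (latSegment p p') (latSegment q q') := by
    rw [Set.disjoint_left]
    unfold latSegment
    rw [segment_eq_image', segment_eq_image']
    rintro _ ⟨α, -, rfl⟩ ⟨β, -, h⟩
    have h' : ∀ i, (q i : ℝ) + β * (q' i - q i) = p i + α * (p' i - p i) := fun i => by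
      simpa [latticePoint_apply] using congrArg (fun x => x.ofLp i) h
    have h0 : ((vol (p' - p) (q' - q) (p - q) : ℤ) : ℝ) = 0 := by
      have e : ∀ i, (p i : ℝ) - q i = β * (q' i - q i) - α * (p' i - p i) := fun i => by
        linarith [h' i]
      simp only [vol, Pi.sub_apply]
      push_cast
      rw [e, e, e]; ring
    have h1 : vol (p' - p) (q' - q) (p - q) = 0 := by exact_mod_cast h0
    rw [h1] at hv
    norm_num at hv
  refine ⟨hdisj, le_antisymm ?_ (le_setDist hk hk3 (isLatticeDKPolytope_latSegment hp hp')
    (isLatticeDKPolytope_latSegment hq hq') hdisj)⟩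
  -- By Cramer's rule, the feet of the common perpendicular have parameters `A / bound k` and `B /
  -- bound k`: the Gram determinant of the directions is their `crossSq`. The four inequalities
  -- assumed place the feet on the segments.
  set A := dot (p - q) (q' - q) * dot (p' - p) (q' - q)
      - dot (p - q) (p' - p) * dot (q' - q) (q' - q) with hA
  set B := dot (p - q) (q' - q) * dot (p' - p) (p' - p)
      - dot (p - q) (p' - p) * dot (p' - p) (q' - q) with hB
  have hmem : ∀ {C : ℤ}, 0 ≤ C → C ≤ bound k → (C / (bound k : ℤ) : ℝ) ∈ Set.Icc (0 : ℝ) 1 := by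
    intro C h0 h1
    constructor
    · have : (0 : ℝ) ≤ C := by exact_mod_cast h0
      positivity
    · rw [div_le_one hb]; exact_mod_cast h1
  set x := latticePoint p + (A / (bound k : ℤ) : ℝ) • (latticePoint p' - latticePoint p) with hx
  set y := latticePoint q + (B / (bound k : ℤ) : ℝ) • (latticePoint q' - latticePoint q) with hy
  have hxm : x ∈ latSegment p p' := by
    unfold latSegment
    rw [segment_eq_image']
    exact ⟨_, hmem hs hs', rfl⟩
  have hym : y ∈ latSegment q q' := by
    unfold latSegment
    rw [segment_eq_image']
    exact ⟨_, hmem ht ht', rfl⟩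
  have hxy : ‖x - y‖ ^ 2 = 1 / (bound k : ℤ) := by
    have hcoord : ∀ i, (x - y) i = ((bound k * (p i - q i) + A * (p' i - p i)
        - B * (q' i - q i) : ℤ) : ℝ) / (bound k : ℤ) := by
      intro i
      simp only [hx, hy, PiLp.sub_apply, PiLp.add_apply, PiLp.smul_apply, latticePoint_apply,
        smul_eq_mul]
      push_cast
      field_simp
      ring
    have hsum : (bound k * (p 0 - q 0) + A * (p' 0 - p 0) - B * (q' 0 - q 0)) ^ 2
        + (bound k * (p 1 - q 1) + A * (p' 1 - p 1) - B * (q' 1 - q 1)) ^ 2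
        + (bound k * (p 2 - q 2) + A * (p' 2 - p 2) - B * (q' 2 - q 2)) ^ 2 = bound k := by
      -- The vector between the feet is the determinant times the cross product of the directions,
      -- divided by `bound k`.
      have e0 : bound k * (p 0 - q 0) + A * (p' 0 - p 0) - B * (q' 0 - q 0) =
          vol (p' - p) (q' - q) (p - q) *
            ((p' - p) 1 * (q' - q) 2 - (p' - p) 2 * (q' - q) 1) := by
        rw [← hc]; simp only [hA, hB, crossSq, vol, dot, Pi.sub_apply]; ring
      have e1 : bound k * (p 1 - q 1) + A * (p' 1 - p 1) - B * (q' 1 - q 1) =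
          vol (p' - p) (q' - q) (p - q) *
            ((p' - p) 2 * (q' - q) 0 - (p' - p) 0 * (q' - q) 2) := by
        rw [← hc]; simp only [hA, hB, crossSq, vol, dot, Pi.sub_apply]; ring
      have e2 : bound k * (p 2 - q 2) + A * (p' 2 - p 2) - B * (q' 2 - q 2) =
          vol (p' - p) (q' - q) (p - q) *
            ((p' - p) 0 * (q' - q) 1 - (p' - p) 1 * (q' - q) 0) := by
        rw [← hc]; simp only [hA, hB, crossSq, vol, dot, Pi.sub_apply]; ring
      rw [e0, e1, e2, mul_pow, mul_pow, mul_pow, hv, one_mul, one_mul, one_mul, ← hc]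
      rfl
    rw [norm_sq_fin_three, hcoord, hcoord, hcoord, div_pow, div_pow, div_pow, ← add_div, ← add_div]
    have : ∀ a b c : ℤ, (a : ℝ) ^ 2 + (b : ℝ) ^ 2 + (c : ℝ) ^ 2 = ((a ^ 2 + b ^ 2 + c ^ 2 : ℤ) : ℝ) :=
      fun a b c => by push_cast; rfl
    rw [this, hsum]
    field_simp
  have hle : setDist (latSegment p p') (latSegment q q') ≤ ‖x - y‖ := by
    rw [← dist_eq_norm]
    refine csInf_le ⟨0, ?_⟩ ⟨x, hxm, y, hym, rfl⟩
    rintro _ ⟨x, -, y, -, rfl⟩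
    exact dist_nonneg
  refine hle.trans ?_
  rw [← Real.sqrt_sq (norm_nonneg (x - y)), hxy, Real.sqrt_div zero_le_one, Real.sqrt_one]

theorem inBox_vec {k : ℕ} {a b c : ℤ} (ha : 0 ≤ a ∧ a ≤ k) (hb : 0 ≤ b ∧ b ≤ k)
    (hc : 0 ≤ c ∧ c ≤ k) : InBox k ![a, b, c] := by
  intro i
  fin_cases i
  · exact ha
  · exact hb
  · exact hc

theorem isLatticeDKPolytope_PStar {k : ℕ} (hk : 4 ≤ k) : IsLatticeDKPolytope 3 k (PStar k) := by
  rw [PStar_eq]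
  exact isLatticeDKPolytope_latSegment (inBox_vec (by omega) (by omega) (by omega))
    (inBox_vec (by omega) (by omega) (by omega))

theorem QStar_eq' (k : ℕ) : QStar k = latSegment ![0, 0, 0] ![(k : ℤ) - 1, k, k] := by
  rw [QStar_eq]
  congr 1
  ext i; fin_cases i <;> rfl

theorem isLatticeDKPolytope_QStar {k : ℕ} (hk : 4 ≤ k) : IsLatticeDKPolytope 3 k (QStar k) := by
  rw [QStar_eq']
  exact isLatticeDKPolytope_latSegment (inBox_vec (by omega) (by omega) (by omega))
    (inBox_vec (by omega) (by omega) (by omega))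

theorem setDist_star {k : ℕ} (hk : 4 ≤ k) : Disjoint (PStar k) (QStar k) ∧
    setDist (PStar k) (QStar k) = 1 / √(bound k) := by
  rw [PStar_eq, QStar_eq']
  -- In terms of `j = k - 4` the four inequalities on the feet become polynomials with nonnegative
  -- coefficients.
  obtain ⟨j, rfl⟩ := Nat.exists_eq_add_of_le hk
  have h0 : (0 : ℤ) ≤ j := by positivity
  refine setDist_latSegment (by omega) (by omega) (inBox_vec (by omega) (by omega) (by omega))
    (inBox_vec (by omega) (by omega) (by omega)) (inBox_vec (by omega) (by omega) (by omega))
    (inBox_vec (by omega) (by omega) (by omega)) ?_ ?_ ?_ ?_ ?_ ?_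
  · simp [crossSq, bound]; ring
  · simp [vol]; right; ring
  all_goals
    simp [dot, bound]
    ring_nf
    linarith [h0, pow_nonneg h0 2, pow_nonneg h0 3, pow_nonneg h0 4]

/-- For `k = 1` the extremal pair is a diagonal of a face and a diagonal of the cube; `k = 2` has
its own explicit pair, and `P*`, `Q*` serve from `k = 4` on. -/
theorem exists_setDist_eq {k : ℕ} (hk : 0 < k) (hk3 : k ≠ 3) :
    ∃ P Q : Set (EuclideanSpace ℝ (Fin 3)), IsLatticeDKPolytope 3 k P ∧
      IsLatticeDKPolytope 3 k Q ∧ Disjoint P Q ∧ setDist P Q = 1 / √(bound k) := by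
  rcases Nat.lt_or_ge k 4 with h4 | h4
  · have hk12 : k = 1 ∨ k = 2 := by omega
    rcases hk12 with rfl | rfl
    · have h1 : InBox 1 ![1, 0, 0] := inBox_vec (by simp) (by simp) (by simp)
      have h2 : InBox 1 ![0, 1, 0] := inBox_vec (by simp) (by simp) (by simp)
      have h3 : InBox 1 ![0, 0, 0] := inBox_vec (by simp) (by simp) (by simp)
      have h4 : InBox 1 ![1, 1, 1] := inBox_vec (by simp) (by simp) (by simp)
      exact ⟨_, _, isLatticeDKPolytope_latSegment h1 h2, isLatticeDKPolytope_latSegment h3 h4,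
        setDist_latSegment hk hk3 h1 h2 h3 h4 (by decide) (by decide) (by decide) (by decide)
          (by decide) (by decide)⟩
    · have h1 : InBox 2 ![1, 0, 0] := inBox_vec (by simp) (by simp) (by simp)
      have h2 : InBox 2 ![0, 1, 2] := inBox_vec (by simp) (by simp) (by simp)
      have h3 : InBox 2 ![0, 0, 1] := inBox_vec (by simp) (by simp) (by simp)
      have h4 : InBox 2 ![2, 2, 2] := inBox_vec (by simp) (by simp) (by simp)
      exact ⟨_, _, isLatticeDKPolytope_latSegment h1 h2, isLatticeDKPolytope_latSegment h3 h4,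
        setDist_latSegment hk hk3 h1 h2 h3 h4 (by decide) (by decide) (by decide) (by decide)
          (by decide) (by decide)⟩
  · exact ⟨_, _, isLatticeDKPolytope_PStar h4, isLatticeDKPolytope_QStar h4, setDist_star h4⟩

theorem isLeast_polytopeDistances {k : ℕ} (hk : 0 < k) (hk3 : k ≠ 3) :
    IsLeast (polytopeDistances 3 k) (1 / √(bound k)) := by
  obtain ⟨P, Q, hP, hQ, hPQ, h⟩ := exists_setDist_eq hk hk3
  refine ⟨⟨P, Q, hP, hQ, hPQ, h⟩, ?_⟩
  rintro _ ⟨P, Q, hP, hQ, hPQ, rfl⟩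
  exact le_setDist hk hk3 hP hQ hPQ

theorem kissingDistance_eq {k : ℕ} (hk : 0 < k) (hk3 : k ≠ 3) :
    kissingDistance 3 k = 1 / √(bound k) :=
  (isLeast_polytopeDistances hk hk3).csInf_eq

/-! ### Uniqueness up to the symmetries of the cube -/

theorem dimension_image {d : ℕ} (σ : EuclideanSpace ℝ (Fin d) ≃ᵃⁱ[ℝ] EuclideanSpace ℝ (Fin d))
    (P : Set (EuclideanSpace ℝ (Fin d))) : dimension (σ '' P) = dimension P := by
  unfold dimension
  have h := σ.toAffineEquiv.toAffineMap.map_vectorSpan (s := P)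
  have h' : vectorSpan ℝ (σ '' P) =
      (vectorSpan ℝ P).map (σ.linearIsometryEquiv.toLinearEquiv : _ →ₗ[ℝ] _) := h.symm
  rw [h']
  exact LinearEquiv.finrank_map_eq _ _

theorem dimension_pos {d : ℕ} {P : Set (EuclideanSpace ℝ (Fin d))} {a b : EuclideanSpace ℝ (Fin d)}
    (ha : a ∈ P) (hb : b ∈ P) (hab : b ≠ a) : 0 < dimension P := by
  have hmem : b - a ∈ vectorSpan ℝ P := vsub_mem_vectorSpan ℝ hb ha
  unfold dimension
  rw [Module.finrank_pos_iff_exists_ne_zero]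
  exact ⟨⟨b - a, hmem⟩, fun h => sub_ne_zero.mpr hab (congrArg Subtype.val h)⟩

/-- A one-dimensional subset of the cube that contains a segment between opposite facets is that
segment. -/
theorem eq_segment_of_dimension_le_one {d k : ℕ} (hk : 0 < k)
    {P : Set (EuclideanSpace ℝ (Fin d))} {a b : EuclideanSpace ℝ (Fin d)} {i : Fin d}
    (ha : a i = 0) (hb : b i = k) (hab : segment ℝ a b ⊆ P) (hP : P ⊆ cube d k)
    (hdim : dimension P ≤ 1) : P = segment ℝ a b := by
  refine Set.Subset.antisymm (fun x hx => ?_) hab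
  have haP := hab (left_mem_segment ℝ a b)
  have hbP := hab (right_mem_segment ℝ a b)
  have hk' : (0 : ℝ) < k := by exact_mod_cast hk
  have hne : b ≠ a := fun h => by rw [h, ha] at hb; exact hk'.ne hb
  have hdim1 : Module.finrank ℝ (vectorSpan ℝ P) = 1 :=
    le_antisymm hdim (dimension_pos haP hbP hne)
  have hbm : b - a ∈ vectorSpan ℝ P := vsub_mem_vectorSpan ℝ hbP haP
  have hxm : x - a ∈ vectorSpan ℝ P := vsub_mem_vectorSpan ℝ hx haP
  obtain ⟨c, hc⟩ := (finrank_eq_one_iff_of_nonzero' (⟨b - a, hbm⟩ : vectorSpan ℝ P)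
    fun h => sub_ne_zero.mpr hne (congrArg Subtype.val h)).mp hdim1 ⟨x - a, hxm⟩
  have hc' : c • (b - a) = x - a := congrArg Subtype.val hc
  -- Coordinate `i` runs from `0` to `k` along the segment, so membership in the cube confines the
  -- parameter `c` to `[0, 1]`.
  have hi : c * k = x i := by
    have := congrArg (fun y => y.ofLp i) hc'
    simpa [ha, hb] using this
  have hxi := hP hx i
  rw [Set.mem_Icc, ← hi] at hxi
  rw [segment_eq_image']
  refine ⟨c, ⟨?_, ?_⟩, ?_⟩
  · by_contra! h
    nlinarith [hxi.1]
  · by_contra! h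
    nlinarith [hxi.2]
  · simp only [hc', add_sub_cancel]

theorem eq_PStar {k : ℕ} (hk : 0 < k) {P : Set (EuclideanSpace ℝ (Fin 3))} (h : PStar k ⊆ P)
    (hP : P ⊆ cube 3 k) (hdim : dimension P ≤ 1) : P = PStar k := by
  unfold PStar at *
  rw [segment_symm] at *
  exact eq_segment_of_dimension_le_one (i := 0) hk (by simp) (by simp) h hP hdim

theorem eq_QStar {k : ℕ} (hk : 0 < k) {Q : Set (EuclideanSpace ℝ (Fin 3))} (h : QStar k ⊆ Q)
    (hQ : Q ⊆ cube 3 k) (hdim : dimension Q ≤ 1) : Q = QStar k :=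
  eq_segment_of_dimension_le_one (i := 1) hk (by simp) (by simp) h hQ hdim

theorem dimension_PStar_pos {k : ℕ} (hk : 0 < k) {P : Set (EuclideanSpace ℝ (Fin 3))}
    (h : PStar k ⊆ P) : 0 < dimension P := by
  refine dimension_pos (h (left_mem_segment ℝ _ _)) (h (right_mem_segment ℝ _ _)) fun h => ?_
  have h0 : (0 : ℝ) = k := by simpa using congrArg (fun y => y.ofLp 0) h
  exact hk.ne (by exact_mod_cast h0)

theorem dimension_QStar_pos {k : ℕ} (hk : 0 < k) {P : Set (EuclideanSpace ℝ (Fin 3))}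
    (h : QStar k ⊆ P) : 0 < dimension P := by
  refine dimension_pos (h (left_mem_segment ℝ _ _)) (h (right_mem_segment ℝ _ _)) fun h => ?_
  have h0 : (k : ℝ) = 0 := by simpa using congrArg (fun y => y.ofLp 1) h
  exact hk.ne' (by exact_mod_cast h0)

/-- Each set contains a nondegenerate segment, so dimensions summing to at most `2` are both `1`,
and neither set can exceed its segment. -/
theorem IsStarPair.of_subset {k : ℕ} (hk : 0 < k) {P Q P' Q' : Set (EuclideanSpace ℝ (Fin 3))}
    (h : IsStarPair k P' Q') (hP' : P' ⊆ P) (hQ' : Q' ⊆ Q) (hP : P ⊆ cube 3 k)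
    (hQ : Q ⊆ cube 3 k) (hdim : dimension P + dimension Q ≤ 2) : IsStarPair k P Q := by
  obtain ⟨σ, hσ, h⟩ := h
  have hσP : σ '' P ⊆ cube 3 k := (Set.image_mono hP).trans hσ.subset
  have hσQ : σ '' Q ⊆ cube 3 k := (Set.image_mono hQ).trans hσ.subset
  rw [← dimension_image σ P, ← dimension_image σ Q] at hdim
  refine ⟨σ, hσ, ?_⟩
  rcases h with ⟨h1, h2⟩ | ⟨h1, h2⟩
  · have g1 : PStar k ⊆ σ '' P := h1 ▸ Set.image_mono hP'
    have g2 : QStar k ⊆ σ '' Q := h2 ▸ Set.image_mono hQ'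
    have := dimension_PStar_pos hk g1
    have := dimension_QStar_pos hk g2
    exact Or.inl ⟨eq_PStar hk g1 hσP (by omega), eq_QStar hk g2 hσQ (by omega)⟩
  · have g1 : QStar k ⊆ σ '' P := h1 ▸ Set.image_mono hP'
    have g2 : PStar k ⊆ σ '' Q := h2 ▸ Set.image_mono hQ'
    have := dimension_QStar_pos hk g1
    have := dimension_PStar_pos hk g2
    exact Or.inr ⟨eq_QStar hk g1 hσP (by omega), eq_PStar hk g2 hσQ (by omega)⟩

end KissingPolytopes

theorem theorem1p1 (k : ℕ) (hk : 0 < k) (hk3 : k ≠ 3) :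
    -- the smallest distance exists, and it has the stated value
    IsLeast (KissingPolytopes.polytopeDistances 3 k) (KissingPolytopes.kissingDistance 3 k) ∧
    KissingPolytopes.kissingDistance 3 k =
      1 / Real.sqrt (2 * (2 * (k : ℝ) ^ 2 - 4 * (k : ℝ) + 5) * (2 * (k : ℝ) ^ 2 - 2 * (k : ℝ) + 1)) ∧
    -- for `k ≥ 6` it is attained by the segments `P*` and `Q*` and, up to the symmetries of the
    -- cube, by no other pair whose dimensions sum to at most `2`
    (6 ≤ k →
      (KissingPolytopes.IsLatticeDKPolytope 3 k (KissingPolytopes.PStar k) ∧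
        KissingPolytopes.IsLatticeDKPolytope 3 k (KissingPolytopes.QStar k) ∧
        Disjoint (KissingPolytopes.PStar k) (KissingPolytopes.QStar k) ∧
        KissingPolytopes.setDist (KissingPolytopes.PStar k) (KissingPolytopes.QStar k) =
          KissingPolytopes.kissingDistance 3 k) ∧
      ∀ P Q : Set (EuclideanSpace ℝ (Fin 3)),
        KissingPolytopes.IsLatticeDKPolytope 3 k P →
        KissingPolytopes.IsLatticeDKPolytope 3 k Q →
        Disjoint P Q →
        KissingPolytopes.dimension P + KissingPolytopes.dimension Q ≤ 2 →
        KissingPolytopes.setDist P Q = KissingPolytopes.kissingDistance 3 k →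
        ∃ σ : EuclideanSpace ℝ (Fin 3) ≃ᵃⁱ[ℝ] EuclideanSpace ℝ (Fin 3),
          KissingPolytopes.IsCubeSymmetry 3 k σ ∧
          ((σ '' P = KissingPolytopes.PStar k ∧ σ '' Q = KissingPolytopes.QStar k) ∨
            (σ '' P = KissingPolytopes.QStar k ∧ σ '' Q = KissingPolytopes.PStar k))) := by
  have hb : ((KissingPolytopes.bound k : ℤ) : ℝ) =
      2 * (2 * (k : ℝ) ^ 2 - 4 * (k : ℝ) + 5) * (2 * (k : ℝ) ^ 2 - 2 * (k : ℝ) + 1) := by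
    simp [KissingPolytopes.bound]
  have heq := KissingPolytopes.kissingDistance_eq hk hk3
  refine ⟨heq ▸ KissingPolytopes.isLeast_polytopeDistances hk hk3, by rw [heq, hb], fun h6 => ?_⟩
  have h4 : 4 ≤ k := by omega
  obtain ⟨hdisj, hdist⟩ := KissingPolytopes.setDist_star h4
  refine ⟨⟨KissingPolytopes.isLatticeDKPolytope_PStar h4,
    KissingPolytopes.isLatticeDKPolytope_QStar h4, hdisj, hdist.trans heq.symm⟩, ?_⟩
  intro P Q hP hQ hPQ hdim hd
  have hpos : (0 : ℝ) < (KissingPolytopes.bound k : ℤ) := by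
    exact_mod_cast KissingPolytopes.bound_pos k
  have h1 : ((KissingPolytopes.bound k : ℤ) : ℝ) * KissingPolytopes.setDist P Q ^ 2 = 1 := by
    rw [hd, heq, div_pow, one_pow, Real.sq_sqrt hpos.le, mul_one_div_cancel hpos.ne']
  obtain ⟨p, p', q, q', hp, hq, hstar⟩ :=
    (KissingPolytopes.one_le_bound_mul_setDist_sq hk hk3 hP hQ hPQ).2 h1 h4
  exact hstar.of_subset hk hp hq hP.2 hQ.2 hdim
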